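/- Let $g\ge 1$ and let $\Gamma$ be a chain of $g$ cycles with arbitrary edge lengths: for $i=1,\dots,g$ the $i$-th cycle carries two distinct points $v_i,w_i$, the clockwise edge from $v_i$ to $w_i$ has length $a_i=\ell(v_iw_i)>0$, the whole cycle has length $\ell_i>a_i$, and for $1\le i<g$ the point $w_i$ is joined to $v_{i+1}$ by a bridge of length $\ge 0$ (length $0$ meaning $w_i=v_{i+1}$). The $i$-th torsion order $m_i$ is the least positive integer $m$ such that $m\,a_i\in\ell_i\mathbb Z$, and $m_i=0$ if $a_i/\ell_i$ is irrational. The torsion profile of $\Gamma$ is $\underline m=(m_2,\dots,m_g)$. For $\xi\in\mathbb R$ let $\langle\xi\rangle_i$ be the point of the $i$-th cycle lying $\xi\,a_i$ units clockwise from $w_i$. Identify a partition $\lambda=(\lambda_0\ge\lambda_1\ge\cdots)$ with its Young diagram $\{(x,y)\in\mathbb Z_{>0}^2 : x\le\lambda_{y-1}\}$. For $w\in\Gamma$ let $$W^\lambda(\Gamma,w)=\{[D]\in\mathrm{Pic}^0(\Gamma) : r(D+d\,w)\ge r \text{ for all } d,r\in\mathbb Z \text{ such that } (g-d+r,\,r+1)\in\lambda\},$$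 where $r(\cdot)$ is the Baker–Norine rank. An $\underline m$-displacement tableau $t$ on $\lambda$, written $t\vdash_{\underline m}\lambda$, is a function $t:\lambda\to\{1,\dots,g\}$ that is strictly increasing along every row and every column of $\lambda$ and such that $x-y\equiv x'-y' \pmod{m_{t(x,y)}}$ for any two distinct boxes $(x,y),(x',y')$ of $\lambda$ with $t(x,y)=t(x',y')$ (the label $1$ is never repeated, so $m_1$ plays no role here). For such $t$ let $\mathbf T(t)\subseteq\mathrm{Pic}^0(\Gamma)$ be the set of classes of divisors of the form $$\sum_{i=1}^g\langle\xi_i\rangle_i-g\,w_g,$$ where $\xi_1,\dots,\xi_g$ are real numbers with $\xi_{t(x,y)}\equiv x-y \pmod{m_{t(x,y)}}$ for all $(x,y)\in\lambda$; a congruence of real numbers modulo $m$ means that their difference lies in $m\mathbb Z$. Then for every partition $\lambda$, $$W^\lambda(\Gamma,w_g)=\bigcup_{t\,\vdash_{\underline m}\,\lambda}\mathbf T(t).$$ -/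

import Mathlib

open Filter Topology
open scoped BigOperators

/-! ## Metric graphs, divisors and rank -/

/-- A (compact, connected) metric graph, presented by a finite connected model: finitely many
vertices and edges (loops and multiple edges are allowed), each edge being a segment of positive
length with a chosen orientation. -/
structure MetricGraph where
  Vertex : Type
  Edge : Type
  vertexFintype : Fintype Vertex
  edgeFintype : Fintype Edge
  src : Edge → Vertex
  tgt : Edge → Vertex
  length : Edge → ℝ
  length_pos : ∀ e, 0 < length e
  nonempty : Nonempty Vertex
  connected : ∀ a b : Vertex, Relation.EqvGen (fun u v => ∃ e, src e = u ∧ tgt e = v) a b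

namespace MetricGraph

variable (Γ : MetricGraph)

instance : Fintype Γ.Vertex := Γ.vertexFintype
instance : Fintype Γ.Edge := Γ.edgeFintype

/-- The genus (first Betti number) of a connected metric graph. -/
def genus : ℤ := (Fintype.card Γ.Edge : ℤ) - (Fintype.card Γ.Vertex : ℤ) + 1

/-- The points of the metric graph: the vertices, and the interior points of the edges. -/
inductive Point : Type
  | vertex (v : Γ.Vertex) : Point
  | interior (e : Γ.Edge) (t : ℝ) (h0 : 0 < t) (h1 : t < Γ.length e) : Point

/-- For `0 ≤ t ≤ length e`, the point of the edge `e` at distance `t` from its source. -/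
noncomputable def onEdge (e : Γ.Edge) (t : ℝ) : Γ.Point :=
  if h0 : 0 < t then
    if h1 : t < Γ.length e then Point.interior e t h0 h1 else Point.vertex (Γ.tgt e)
  else Point.vertex (Γ.src e)

/-- A rational function: a continuous piecewise linear real function with integer slopes. This is
expressed locally: at every point and in every direction along an edge, the function is affine
with integer slope on a short segment starting at the point. (Continuity follows, and
compactness of the edges leaves only finitely many changes of slope.) The integers
`fwd e t` and `bwd e t` are the outgoing slopes at the point `t` of the edge `e`, in the direction
of the target and of the source of `e` respectively. -/
structure RationalFunction where
  toFun : Γ.Point → ℝ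
  fwd : Γ.Edge → ℝ → ℤ
  bwd : Γ.Edge → ℝ → ℤ
  eventually_fwd : ∀ (e : Γ.Edge) (t : ℝ), 0 ≤ t → t < Γ.length e →
    ∀ᶠ s in 𝓝[>] (0 : ℝ),
      toFun (Γ.onEdge e (t + s)) = toFun (Γ.onEdge e t) + (fwd e t : ℝ) * s
  eventually_bwd : ∀ (e : Γ.Edge) (t : ℝ), 0 < t → t ≤ Γ.length e →
    ∀ᶠ s in 𝓝[>] (0 : ℝ),
      toFun (Γ.onEdge e (t - s)) = toFun (Γ.onEdge e t) + (bwd e t : ℝ) * s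

open Classical in
/-- The order of a rational function at a point: the sum of its outgoing slopes there. -/
noncomputable def RationalFunction.ord {Γ : MetricGraph} (f : Γ.RationalFunction) : Γ.Point → ℤ
  | Point.vertex v => ∑ e : Γ.Edge,
      ((if Γ.src e = v then f.fwd e 0 else 0) + (if Γ.tgt e = v then f.bwd e (Γ.length e) else 0))
  | Point.interior e t _ _ => f.fwd e t + f.bwd e t

/-- Divisors: finite formal integer combinations of points. -/
abbrev Divisor : Type := Γ.Point →₀ ℤ

/-- The group of principal divisors, i.e. the divisors of rational functions. -/
def principal : AddSubgroup Γ.Divisor where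
  carrier := {D | ∃ f : Γ.RationalFunction, ∀ p, D p = f.ord p}
  zero_mem' := by
    refine ⟨⟨fun _ => 0, fun _ _ => 0, fun _ _ => 0, ?_, ?_⟩, ?_⟩
    · intros; simp
    · intros; simp
    · rintro (v | ⟨e, t, h0, h1⟩) <;> simp [RationalFunction.ord]
  add_mem' := by
    rintro D D' ⟨f, hf⟩ ⟨f', hf'⟩
    refine ⟨⟨fun p => f.toFun p + f'.toFun p, fun e t => f.fwd e t + f'.fwd e t,
      fun e t => f.bwd e t + f'.bwd e t, ?_, ?_⟩, ?_⟩
    · intro e t h0 h1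
      filter_upwards [f.eventually_fwd e t h0 h1, f'.eventually_fwd e t h0 h1] with s h h'
      rw [h, h']; push_cast; ring
    · intro e t h0 h1
      filter_upwards [f.eventually_bwd e t h0 h1, f'.eventually_bwd e t h0 h1] with s h h'
      rw [h, h']; push_cast; ring
    · rintro (v | ⟨e, t, h0, h1⟩)
      · rw [Finsupp.add_apply, hf, hf']
        simp only [RationalFunction.ord]
        rw [← Finset.sum_add_distrib]
        refine Finset.sum_congr rfl fun e _ => ?_
        split_ifs <;> ring
      · rw [Finsupp.add_apply, hf, hf']
        simp only [RationalFunction.ord]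
        ring
  neg_mem' := by
    rintro D ⟨f, hf⟩
    refine ⟨⟨fun p => -f.toFun p, fun e t => -f.fwd e t, fun e t => -f.bwd e t, ?_, ?_⟩, ?_⟩
    · intro e t h0 h1
      filter_upwards [f.eventually_fwd e t h0 h1] with s h
      rw [h]; push_cast; ring
    · intro e t h0 h1
      filter_upwards [f.eventually_bwd e t h0 h1] with s h
      rw [h]; push_cast; ring
    · rintro (v | ⟨e, t, h0, h1⟩)
      · rw [Finsupp.neg_apply, hf]
        simp only [RationalFunction.ord]
        rw [← Finset.sum_neg_distrib]
        refine Finset.sum_congr rfl fun e _ => ?_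
        split_ifs <;> ring
      · rw [Finsupp.neg_apply, hf]
        simp only [RationalFunction.ord]
        ring

/-- The degree of a divisor. -/
noncomputable def deg : Γ.Divisor →+ ℤ := Finsupp.degree

/-- The group of divisors of degree zero. -/
noncomputable def Div0 : AddSubgroup Γ.Divisor := Γ.deg.ker

/-- The group `Pic⁰` of linear equivalence classes of divisors of degree zero. -/
abbrev Pic0 : Type := Γ.Div0 ⧸ Γ.principal.addSubgroupOf Γ.Div0

/-- The divisor class in `Pic⁰` of a divisor of degree zero. -/
noncomputable def toPic0 (D : Γ.Div0) : Γ.Pic0 := QuotientAddGroup.mk D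

/-- `D` is linearly equivalent to an effective divisor, i.e. the linear series `|D|` is
nonempty. -/
def IsEquivEffective (D : Γ.Divisor) : Prop :=
  ∃ D' : Γ.Divisor, 0 ≤ D' ∧ D - D' ∈ Γ.principal

/-- The Baker–Norine rank of `D` is at least `r`: for every effective divisor `E` of degree `r`,
the linear series `|D - E|` is nonempty. (For `r < 0` this always holds, as it should since the
rank is at least `-1`.) -/
def RankGE (D : Γ.Divisor) (r : ℤ) : Prop :=
  ∀ E : Γ.Divisor, 0 ≤ E → Γ.deg E = r → Γ.IsEquivEffective (D - E)

end MetricGraph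

/-! ## Partitions and Brill–Noether loci -/

/-- A cell of a Young diagram is a pair (row, column) of natural numbers. It represents the box
`(x, y)` with `x = column + 1` and `y = row + 1`; this is its first coordinate `x`. -/
def boxX (c : ℕ × ℕ) : ℤ := (c.2 : ℤ) + 1

/-- The second coordinate `y = row + 1` of the box represented by a cell. -/
def boxY (c : ℕ × ℕ) : ℤ := (c.1 : ℤ) + 1

/-- The integer point `(x, y)` is a box of the partition `lam`, the partition
`(lam₀ ≥ lam₁ ≥ ⋯)` being identified with `{(x, y) : 1 ≤ y, 1 ≤ x ≤ lam_{y-1}}`. -/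
def HasBox (lam : YoungDiagram) (x y : ℤ) : Prop :=
  ∃ c ∈ lam, boxX c = x ∧ boxY c = y

/-- The Brill–Noether locus `W^lam(Γ, w) ⊆ Pic⁰(Γ)` of a partition `lam` on the marked metric
graph `(Γ, w)`: the classes `[D]` such that `D + d • w` has rank at least `r` whenever
`(genus - d + r, r + 1)` is a box of `lam`. -/
def MetricGraph.W (Γ : MetricGraph) (w : Γ.Point) (lam : YoungDiagram) : Set Γ.Pic0 :=
  {c | ∃ D : Γ.Div0, Γ.toPic0 D = c ∧
    ∀ d r : ℤ, HasBox lam (Γ.genus - d + r) (r + 1) →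
      Γ.RankGE ((D : Γ.Divisor) + d • Finsupp.single w 1) r}

/-! ## Chains of cycles -/

/-- The data of a chain of `g` cycles. The `i`-th cycle consists of two points `v i ≠ w i`, the
clockwise edge from `v i` to `w i`, of length `a i`, and the clockwise edge from `w i` to `v i`, of
length `b i`. The point `w i` is joined to `v (i + 1)` by a bridge of length `bridge i ≥ 0`; a
bridge of length zero means that `w i` and `v (i + 1)` are the same point.
Cycles are numbered from `0` to `g - 1`. -/
structure ChainOfCycles (g : ℕ) where
  a : Fin g → ℝ
  b : Fin g → ℝ
  bridge : Fin (g - 1) → ℝ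
  a_pos : ∀ i, 0 < a i
  b_pos : ∀ i, 0 < b i
  bridge_nonneg : ∀ j, 0 ≤ bridge j

namespace ChainOfCycles

variable {g : ℕ} (C : ChainOfCycles g)

/-- The bridges of positive length. -/
abbrev OpenBridge : Type := {j : Fin (g - 1) // 0 < C.bridge j}

/-- The distinct vertices of the chain: all the points `w i`, the first point `v 0`, and
the points `v (j + 1)` at the right end of a bridge `j` of positive length. -/
inductive Vertex : Type
  | right (i : Fin g) : Vertex
  | start : Vertex
  | left (j : C.OpenBridge) : Vertex

/-- The edges: for each cycle `i` the clockwise edges `v i → w i` and `w i → v i`, and the bridges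
of positive length. -/
inductive Edge : Type
  | vw (i : Fin g) : Edge
  | wv (i : Fin g) : Edge
  | link (j : C.OpenBridge) : Edge

/-- The vertex `w i`. -/
def w (i : Fin g) : C.Vertex := Vertex.right i

/-- The vertex `v i`; it coincides with `w (i - 1)` if the bridge between them has length zero. -/
noncomputable def v (i : Fin g) : C.Vertex :=
  if h : i.val = 0 then Vertex.start
  else
    if hb : 0 < C.bridge ⟨i.val - 1, by omega⟩ then Vertex.left ⟨⟨i.val - 1, by omega⟩, hb⟩
    else C.w ⟨i.val - 1, by omega⟩

/-- The source of an edge. -/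
noncomputable def src : C.Edge → C.Vertex
  | Edge.vw i => C.v i
  | Edge.wv i => C.w i
  | Edge.link j => C.w ⟨j.val.val, by omega⟩

/-- The target of an edge. -/
noncomputable def tgt : C.Edge → C.Vertex
  | Edge.vw i => C.w i
  | Edge.wv i => C.v i
  | Edge.link j => C.v ⟨j.val.val + 1, by omega⟩

/-- The length of an edge. -/
def edgeLength : C.Edge → ℝ
  | Edge.vw i => C.a i
  | Edge.wv i => C.b i
  | Edge.link j => C.bridge j.val

theorem edgeLength_pos (e : C.Edge) : 0 < C.edgeLength e := by
  cases e with
  | vw i => exact C.a_pos i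
  | wv i => exact C.b_pos i
  | link j => exact j.property

theorem finite_vertex : Finite C.Vertex := by
  let f : C.Vertex → Fin g ⊕ Option C.OpenBridge := fun x => match x with
    | Vertex.right i => Sum.inl i
    | Vertex.start => Sum.inr none
    | Vertex.left j => Sum.inr (some j)
  refine Finite.of_injective f ?_
  rintro (i | _ | j) (i' | _ | j') h <;> simp_all [f]

theorem finite_edge : Finite C.Edge := by
  let f : C.Edge → (Fin g ⊕ Fin g) ⊕ C.OpenBridge := fun x => match x with
    | Edge.vw i => Sum.inl (Sum.inl i)
    | Edge.wv i => Sum.inl (Sum.inr i)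
    | Edge.link j => Sum.inr j
  refine Finite.of_injective f ?_
  rintro (i | i | j) (i' | i' | j') h <;> simp_all [f]

theorem connected_start (x : C.Vertex) :
    Relation.EqvGen (fun u v => ∃ e, C.src e = u ∧ C.tgt e = v) Vertex.start x := by
  have hw : ∀ (n : ℕ) (hn : n < g),
      Relation.EqvGen (fun u v => ∃ e, C.src e = u ∧ C.tgt e = v) Vertex.start (C.v ⟨n, hn⟩) ∧
      Relation.EqvGen (fun u v => ∃ e, C.src e = u ∧ C.tgt e = v) Vertex.start (C.w ⟨n, hn⟩) := by
    intro n
    induction n with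
    | zero =>
      intro hn
      have h0 : C.v ⟨0, hn⟩ = Vertex.start := by simp [v]
      refine ⟨h0 ▸ Relation.EqvGen.refl _, ?_⟩
      exact Relation.EqvGen.rel _ _ ⟨Edge.vw ⟨0, hn⟩, h0, rfl⟩
    | succ n ih =>
      intro hn
      have hv : Relation.EqvGen (fun u v => ∃ e, C.src e = u ∧ C.tgt e = v) Vertex.start
          (C.v ⟨n + 1, hn⟩) := by
        by_cases hb : 0 < C.bridge ⟨n, by omega⟩
        · exact (ih (by omega)).2.trans _ _ _
            (Relation.EqvGen.rel _ _ ⟨Edge.link ⟨⟨n, by omega⟩, hb⟩, rfl, rfl⟩)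
        · have h1 : C.v ⟨n + 1, hn⟩ = C.w ⟨n, by omega⟩ := by simp [v, hb]
          rw [h1]
          exact (ih (by omega)).2
      exact ⟨hv, hv.trans _ _ _ (Relation.EqvGen.rel _ _ ⟨Edge.vw ⟨n + 1, hn⟩, rfl, rfl⟩)⟩
  cases x with
  | right i => exact (hw i.val i.isLt).2
  | start => exact Relation.EqvGen.refl _
  | left j =>
    have h1 : C.v ⟨j.val.val + 1, by omega⟩ = Vertex.left j := by
      have := j.property
      simp [v, this]
    exact h1 ▸ (hw (j.val.val + 1) (by omega)).1

/-- The chain of cycles as a metric graph. -/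
noncomputable def graph : MetricGraph where
  Vertex := C.Vertex
  Edge := C.Edge
  vertexFintype := @Fintype.ofFinite _ C.finite_vertex
  edgeFintype := @Fintype.ofFinite _ C.finite_edge
  src := C.src
  tgt := C.tgt
  length := C.edgeLength
  length_pos := C.edgeLength_pos
  nonempty := ⟨Vertex.start⟩
  connected := fun x y => (C.connected_start x).symm.trans _ _ _ (C.connected_start y)

/-- The length of the `i`-th cycle. -/
def cycleLength (i : Fin g) : ℝ := C.a i + C.b i

theorem cycleLength_pos (i : Fin g) : 0 < C.cycleLength i := add_pos (C.a_pos i) (C.b_pos i)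

/-- The `i`-th torsion order: the least positive integer `m` such that `m • a i` is an integer
multiple of the length of the cycle, and `0` if there is none (that is, if `a i` is an irrational
multiple of the length), by the convention that the infimum of the empty set is `0`. -/
noncomputable def torsionOrder (i : Fin g) : ℕ :=
  sInf {m : ℕ | 0 < m ∧ ∃ k : ℤ, (m : ℝ) * C.a i = (k : ℝ) * C.cycleLength i}

/-- The point `⟨ξ⟩ᵢ` of the `i`-th cycle that lies `ξ * a i` units clockwise from `w i`: reduce
this distance modulo the length of the cycle, then walk from `w i` to `v i` along the edge of
length `b i`, and if necessary from `v i` on towards `w i` along the edge of length `a i`. -/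
noncomputable def cyclePoint (i : Fin g) (ξ : ℝ) : C.graph.Point :=
  let s : ℝ := toIcoMod (C.cycleLength_pos i) 0 (ξ * C.a i)
  if s ≤ C.b i then C.graph.onEdge (Edge.wv i) s
  else C.graph.onEdge (Edge.vw i) (s - C.b i)

/-- The marked point `w_g`, on the last cycle. -/
def marked (hg : 0 < g) : C.graph.Point :=
  MetricGraph.Point.vertex (C.w ⟨g - 1, by omega⟩)

end ChainOfCycles

/-! ## Displacement tableaux and tori -/

/-- `t` is an `m`-displacement tableau on `lam`: it is strictly increasing along rows and columns,
and boxes `(x, y)`, `(x', y')` with the same label `i` satisfy `x - y ≡ x' - y' (mod m i)`.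
The `g` labels are numbered from `0` to `g - 1`, like the cycles. The first label
cannot be repeated in view of the first two conditions, so that `m 0` is irrelevant. -/
def IsDisplacementTableau {g : ℕ} (m : Fin g → ℕ) (lam : YoungDiagram)
    (t : {c : ℕ × ℕ // c ∈ lam} → Fin g) : Prop :=
  (∀ c c', boxY c.val = boxY c'.val → boxX c.val < boxX c'.val → t c < t c') ∧
  (∀ c c', boxX c.val = boxX c'.val → boxY c.val < boxY c'.val → t c < t c') ∧
  (∀ c c', c ≠ c' → t c = t c' →
    boxX c.val - boxY c.val ≡ boxX c'.val - boxY c'.val [ZMOD (m (t c) : ℤ)])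

/-- The torus `T(t) ⊆ Pic⁰`: the classes of the divisors `∑ᵢ ⟨ξᵢ⟩ᵢ - g • w_g`, where the `ξᵢ` are real
numbers such that `ξᵢ ≡ x - y` modulo the torsion order `mᵢ` for all boxes `(x, y)` with
label `i`. The congruence of real numbers means that the difference is an integer
multiple of `mᵢ`. -/
def ChainOfCycles.T {g : ℕ} (C : ChainOfCycles g) (hg : 0 < g) {lam : YoungDiagram}
    (t : {c : ℕ × ℕ // c ∈ lam} → Fin g) : Set C.graph.Pic0 :=
  {c | ∃ (D : C.graph.Div0) (ξ : Fin g → ℝ), C.graph.toPic0 D = c ∧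
    (D : C.graph.Divisor) =
      (∑ i, Finsupp.single (C.cyclePoint i (ξ i)) 1) - (g : ℤ) • Finsupp.single (C.marked hg) 1 ∧
    ∀ p : {c : ℕ × ℕ // c ∈ lam},
      ξ (t p) ≡ ((boxX p.val - boxY p.val : ℤ) : ℝ) [PMOD (C.torsionOrder (t p) : ℝ)]}

/-! ## Piecewise linear functions on a segment -/

/-! Cycles are numbered from 0. Contracting everything but cycle `i` sends whatever lies to its left
to `v i`, at position `-a i`, and whatever lies to its right to `w i`, at position `0`. Summing
positions gives a coordinate `aj i` of divisors in `ℝ/ℓᵢ`, and the marked point has all coordinates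
zero. The Abel–Jacobi theorem `mem_principal_iff` says that a divisor is principal exactly when its
degree and all its coordinates vanish. Necessity is integration by parts
(`RationalFunction.sum_ord_smul`). Sufficiency holds because translation along a cycle is a
homomorphism from the circle to the Picard group, by a tropical theta function
(`single_cyc_add_mem_principal`), while moving along a bridge does not change the class.

Suppose that an effective divisor has `N i` chips on the cycles before `i`. These contribute `-N i •
a i` to coordinate `i`. A cycle that carries a chip can realise any coordinate; a cycle without
chips leaves exactly this one. So `D` is equivalent to an effective divisor exactly when some
nondecreasing walk `N` from `0` ends at most at `deg D` and stays constant only at cycles where `aj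
i D + N i • a i = 0`.

The rank at the marked point is then a game. Let `M n c` be the number of chips forced on the first
`n` cycles when the worst effective divisor with `c` chips there is subtracted from `D`. If the
subtracted divisor has no chip on cycle `n`, the count rises by one unless `aj n D + (M n c + c) • a
n = 0`; a chip subtracted on cycle `n` can always be placed so as to force the rise. Put `R n c = M
n c + c - n`. Then `R (n+1) c` is the maximum of `R n (c-1) + 1` and of `R n c`, lowered by one if
`D` resonates there. This is displacement of partitions: row `c` has length `c - R n c`, and it
gains a box when its diagonal resonates and the previous row is longer. The outcome is `rankGE_iff`.

Hence `W^lam` consists of the classes whose displaced partition contains `lam`. Recording the step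
at which each box appears gives a tableau (`displacementRow_le_iff_exists_tableau`). Label `i` is
admissible at `(x, y)` when `aj i D = (x - y - i) • a i`, which is the coordinate of a torus divisor
with `ξᵢ ≡ x - y`, because the torsion order is the order of `a i` in the circle. -/

theorem eventually_nhdsGT_zero_iff {p : ℝ → Prop} :
    (∀ᶠ s in 𝓝[>] (0 : ℝ), p s) ↔ ∃ δ > 0, ∀ s, 0 < s → s < δ → p s := by
  rw [Filter.Eventually, mem_nhdsGT_iff_exists_Ioo_subset]
  constructor
  · rintro ⟨u, hu, h⟩
    exact ⟨u, hu, fun s h0 h1 => h ⟨h0, h1⟩⟩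
  · rintro ⟨u, hu, h⟩
    exact ⟨u, hu, fun s hs => h s hs.1 hs.2⟩

theorem affine_eq_const {x y c : ℝ} (h : ∀ᶠ s in 𝓝[>] (0 : ℝ), c = x + y * s) :
    x = c ∧ y = 0 := by
  obtain ⟨δ, hδ, h⟩ := eventually_nhdsGT_zero_iff.1 h
  have h1 := h (δ / 2) (by linarith) (by linarith)
  have h2 := h (δ / 4) (by linarith) (by linarith)
  have h3 : y * (δ / 4) = 0 := by linarith
  have h4 : y = 0 := by
    rcases mul_eq_zero.1 h3 with h | h
    · exact h
    · linarith
  subst h4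
  exact ⟨by linarith, rfl⟩

/-- A locally affine function on a segment, starting with slope zero and without change of slope,
is constant. -/
theorem const_of_no_slope_change {L : ℝ} (hL : 0 < L) {q fw bw : ℝ → ℝ}
    (hf : ∀ t, 0 ≤ t → t < L → ∀ᶠ s in 𝓝[>] (0 : ℝ), q (t + s) = q t + fw t * s)
    (hb : ∀ t, 0 < t → t ≤ L → ∀ᶠ s in 𝓝[>] (0 : ℝ), q (t - s) = q t + bw t * s)
    (h0 : fw 0 = 0) (h1 : ∀ t, 0 < t → t < L → fw t + bw t = 0) :
    q L = q 0 ∧ bw L = 0 := by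
  -- `T` ends the initial stretch on which `q` is constant. The slope at `T` towards the left is
  -- zero, hence so is the one towards the right, and the stretch would continue past `T` if `T <
  -- L`.
  let S : Set ℝ := {t | 0 ≤ t ∧ t ≤ L ∧ ∀ u, 0 ≤ u → u ≤ t → q u = q 0}
  have h0S : (0 : ℝ) ∈ S := ⟨le_rfl, hL.le, fun u h h' => by rw [le_antisymm h' h]⟩
  have hbdd : BddAbove S := ⟨L, fun t ht => ht.2.1⟩
  let T := sSup S
  have hT0 : 0 ≤ T := le_csSup hbdd h0S
  have hTL : T ≤ L := csSup_le ⟨0, h0S⟩ fun t ht => ht.2.1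
  have hlt : ∀ u, 0 ≤ u → u < T → q u = q 0 := fun u hu huT => by
    obtain ⟨t, ht, hut⟩ := exists_lt_of_lt_csSup ⟨0, h0S⟩ huT
    exact ht.2.2 u hu hut.le
  have hTb : 0 < T → q T = q 0 ∧ bw T = 0 := fun hT => by
    apply affine_eq_const
    have h2 : ∀ᶠ s in 𝓝[>] (0 : ℝ), s < T := eventually_nhdsGT_zero_iff.2 ⟨T, hT, fun _ _ h => h⟩
    filter_upwards [hb T hT hTL, h2, self_mem_nhdsWithin] with s hs hsT hs0
    rw [← hs]
    exact (hlt _ (by linarith) (by have : (0 : ℝ) < s := hs0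
                                   linarith)).symm
  have hTq : q T = q 0 := by
    rcases hT0.eq_or_lt with h | h
    · rw [← h]
    · exact (hTb h).1
  have hTeq : T = L := by
    by_contra hne
    have hTlt : T < L := lt_of_le_of_ne hTL hne
    have hfT : fw T = 0 := by
      rcases hT0.eq_or_lt with h | h
      · rw [← h, h0]
      · have := h1 T h hTlt
        rw [(hTb h).2] at this
        linarith
    obtain ⟨δ, hδ, h⟩ := eventually_nhdsGT_zero_iff.1 (hf T hT0 hTlt)
    have hm : 0 < min (δ / 2) (L - T) := lt_min (by linarith) (by linarith)
    have hmem : T + min (δ / 2) (L - T) ∈ S := by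
      refine ⟨by linarith, by linarith [min_le_right (δ / 2) (L - T)], fun u hu0 hu => ?_⟩
      rcases lt_trichotomy u T with h' | h' | h'
      · exact hlt u hu0 h'
      · rw [h', hTq]
      · have := h (u - T) (by linarith) (by linarith [min_le_left (δ / 2) (L - T)])
        rw [hfT, hTq] at this
        simpa using this
    have := le_csSup hbdd hmem
    change _ ≤ T at this
    linarith
  have := hTb (by rw [hTeq]; exact hL)
  rwa [hTeq] at this

theorem eventually_max_add (c : ℝ) :
    ∀ᶠ s in 𝓝[>] (0 : ℝ), max (c + s) 0 = max c 0 + (if 0 ≤ c then 1 else 0) * s := by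
  rw [eventually_nhdsGT_zero_iff]
  rcases le_or_gt 0 c with h | h
  · refine ⟨1, one_pos, fun s hs _ => ?_⟩
    rw [if_pos h, max_eq_left h, max_eq_left (by linarith), one_mul]
  · refine ⟨-c, by linarith, fun s hs hs' => ?_⟩
    rw [if_neg h.not_ge, max_eq_right h.le, max_eq_right (by linarith)]
    simp

theorem eventually_max_sub (c : ℝ) :
    ∀ᶠ s in 𝓝[>] (0 : ℝ), max (c - s) 0 = max c 0 - (if 0 < c then 1 else 0) * s := by
  rw [eventually_nhdsGT_zero_iff]
  rcases lt_or_ge 0 c with h | h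
  · refine ⟨c, h, fun s hs hs' => ?_⟩
    rw [if_pos h, max_eq_left h.le, max_eq_left (by linarith), one_mul]
  · refine ⟨1, one_pos, fun s hs hs' => ?_⟩
    rw [if_neg h.not_gt, max_eq_right h, max_eq_right (by linarith)]
    simp

/-- The total mass and the first moment of the second derivative of a piecewise linear function on
a segment. -/
theorem piecewise_linear_moments {L : ℝ} (hL : 0 < L) {h : ℝ → ℝ} {fw bw : ℝ → ℤ}
    (hf : ∀ t, 0 ≤ t → t < L → ∀ᶠ s in 𝓝[>] (0 : ℝ), h (t + s) = h t + (fw t : ℝ) * s)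
    (hb : ∀ t, 0 < t → t ≤ L → ∀ᶠ s in 𝓝[>] (0 : ℝ), h (t - s) = h t + (bw t : ℝ) * s)
    (S : Finset ℝ) (hS : ∀ t ∈ S, 0 < t ∧ t < L)
    (h1 : ∀ t, 0 < t → t < L → t ∉ S → fw t + bw t = 0) :
    fw 0 + bw L + ∑ t ∈ S, (fw t + bw t) = 0 ∧
      (bw L : ℝ) * L + ∑ t ∈ S, ((fw t + bw t : ℤ) : ℝ) * t = h 0 - h L := by
  -- Subtracting the initial slope and one ramp `max (t - s) 0` per break point leaves a function
  -- without slope changes. Its final slope and final value give the two identities.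
  have key := const_of_no_slope_change hL
    (q := fun t => h t - fw 0 * t - ∑ s ∈ S, ((fw s + bw s : ℤ) : ℝ) * max (t - s) 0)
    (fw := fun t => fw t - fw 0 -
      ∑ s ∈ S, ((fw s + bw s : ℤ) : ℝ) * (if 0 ≤ t - s then 1 else 0))
    (bw := fun t => bw t + fw 0 +
      ∑ s ∈ S, ((fw s + bw s : ℤ) : ℝ) * (if 0 < t - s then 1 else 0)) ?_ ?_ ?_ ?_
  · obtain ⟨k1, k2⟩ := key
    have e1 : ∑ s ∈ S, ((fw s + bw s : ℤ) : ℝ) * (if 0 < L - s then (1 : ℝ) else 0)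
        = ((∑ s ∈ S, (fw s + bw s) : ℤ) : ℝ) := by
      rw [Int.cast_sum]
      refine Finset.sum_congr rfl fun s hs => ?_
      rw [if_pos (by linarith [(hS s hs).2]), mul_one]
    have e2 : ∑ s ∈ S, ((fw s + bw s : ℤ) : ℝ) * max (L - s) 0
        = ((∑ s ∈ S, (fw s + bw s) : ℤ) : ℝ) * L - ∑ s ∈ S, ((fw s + bw s : ℤ) : ℝ) * s := by
      rw [Int.cast_sum, Finset.sum_mul, ← Finset.sum_sub_distrib]
      refine Finset.sum_congr rfl fun s hs => ?_
      rw [max_eq_left (by linarith [(hS s hs).2]), mul_sub]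
    have e3 : ∑ s ∈ S, ((fw s + bw s : ℤ) : ℝ) * max (0 - s) 0 = 0 := by
      refine Finset.sum_eq_zero fun s hs => ?_
      rw [max_eq_right (by linarith [(hS s hs).1]), mul_zero]
    simp only [e1, e2, e3] at k1 k2
    constructor
    · have : ((fw 0 + bw L + ∑ t ∈ S, (fw t + bw t) : ℤ) : ℝ) = 0 := by
        rw [Int.cast_add, Int.cast_add]; linarith
      exact_mod_cast this
    · linear_combination L * k2 + k1
  · intro t ht ht'
    have : ∀ᶠ s in 𝓝[>] (0 : ℝ), ∀ u ∈ S,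
        max (t - u + s) 0 = max (t - u) 0 + (if 0 ≤ t - u then 1 else 0) * s :=
      (Filter.eventually_all_finset S).2 fun u _ => eventually_max_add _
    filter_upwards [hf t ht ht', this] with s hs hs'
    have e : ∑ u ∈ S, ((fw u + bw u : ℤ) : ℝ) * max (t + s - u) 0
        = ∑ u ∈ S, ((fw u + bw u : ℤ) : ℝ) * max (t - u) 0
          + (∑ u ∈ S, ((fw u + bw u : ℤ) : ℝ) * (if 0 ≤ t - u then 1 else 0)) * s := by
      rw [Finset.sum_mul, ← Finset.sum_add_distrib]
      refine Finset.sum_congr rfl fun u hu => ?_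
      rw [show t + s - u = t - u + s by ring, hs' u hu]
      ring
    rw [hs, e]
    ring
  · intro t ht ht'
    have : ∀ᶠ s in 𝓝[>] (0 : ℝ), ∀ u ∈ S,
        max (t - u - s) 0 = max (t - u) 0 - (if 0 < t - u then 1 else 0) * s :=
      (Filter.eventually_all_finset S).2 fun u _ => eventually_max_sub _
    filter_upwards [hb t ht ht', this] with s hs hs'
    have e : ∑ u ∈ S, ((fw u + bw u : ℤ) : ℝ) * max (t - s - u) 0
        = ∑ u ∈ S, ((fw u + bw u : ℤ) : ℝ) * max (t - u) 0
          - (∑ u ∈ S, ((fw u + bw u : ℤ) : ℝ) * (if 0 < t - u then 1 else 0)) * s := by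
      rw [Finset.sum_mul, ← Finset.sum_sub_distrib]
      refine Finset.sum_congr rfl fun u hu => ?_
      rw [show t - s - u = t - u - s by ring, hs' u hu]
      ring
    rw [hs, e]
    ring
  · simp only [sub_self, zero_sub, neg_eq_zero]
    refine Finset.sum_eq_zero fun s hs => ?_
    rw [if_neg (by linarith [(hS s hs).1]), mul_zero]
  · intro t ht ht'
    have e : ∑ u ∈ S, ((fw u + bw u : ℤ) : ℝ) * (if 0 ≤ t - u then 1 else 0)
        = ∑ u ∈ S, ((fw u + bw u : ℤ) : ℝ) * (if 0 < t - u then 1 else 0)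
          + ((fw t + bw t : ℤ) : ℝ) := by
      have e1 : ((fw t + bw t : ℤ) : ℝ)
          = ∑ u ∈ S, if t = u then ((fw u + bw u : ℤ) : ℝ) else 0 := by
        rw [Finset.sum_ite_eq]
        split_ifs with htS
        · rfl
        · rw [h1 t ht ht' htS, Int.cast_zero]
      rw [e1, ← Finset.sum_add_distrib]
      refine Finset.sum_congr rfl fun u _ => ?_
      rcases lt_trichotomy u t with hu | hu | hu
      · rw [if_pos (by linarith), if_pos (by linarith), if_neg hu.ne', add_zero]
      · subst hu; simp
      · rw [if_neg (by linarith), if_neg (by linarith), if_neg hu.ne, add_zero]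
    rw [e]
    push_cast
    ring

/-! ### Integration by parts on a metric graph -/

namespace MetricGraph

variable {Γ : MetricGraph}

theorem onEdge_zero (e : Γ.Edge) : Γ.onEdge e 0 = Point.vertex (Γ.src e) := by
  simp [onEdge]

theorem onEdge_length (e : Γ.Edge) : Γ.onEdge e (Γ.length e) = Point.vertex (Γ.tgt e) := by
  simp [onEdge, Γ.length_pos e]

theorem onEdge_interior (e : Γ.Edge) {t : ℝ} (h0 : 0 < t) (h1 : t < Γ.length e) :
    Γ.onEdge e t = Point.interior e t h0 h1 := by
  simp [onEdge, h0, h1]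

/-- A divisor, summed over the vertices and over the interiors of the edges. -/
theorem sum_eq_sum_vertex_add_sum_edge {A : Type*} [AddCommGroup A] (D : Γ.Divisor)
    (κ : Γ.Point → A) : ∃ S : Γ.Edge → Finset ℝ,
      (∀ e, ∀ t ∈ S e, 0 < t ∧ t < Γ.length e) ∧
      (∀ e t h0 h1, t ∉ S e → D (Point.interior e t h0 h1) = 0) ∧
      D.sum (fun p n => n • κ p) = ∑ v, D (Point.vertex v) • κ (Point.vertex v) +
        ∑ e, ∑ t ∈ S e, D (Γ.onEdge e t) • κ (Γ.onEdge e t) := by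
  classical
  have hinj : ∀ e, Set.InjOn (Γ.onEdge e) (Set.Ioo 0 (Γ.length e)) := by
    intro e s hs t ht h
    rw [onEdge_interior e hs.1 hs.2, onEdge_interior e ht.1 ht.2] at h
    simpa using h
  have hfin : ∀ e, (Set.Ioo 0 (Γ.length e) ∩ Γ.onEdge e ⁻¹' (D.support : Set Γ.Point)).Finite := by
    intro e
    refine Set.Finite.of_finite_image (f := Γ.onEdge e) ?_ ?_
    · exact D.support.finite_toSet.subset (by rintro _ ⟨t, ht, rfl⟩; exact ht.2)
    · exact fun s hs t ht h => hinj e hs.1 ht.1 h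
  let S : Γ.Edge → Finset ℝ := fun e => (hfin e).toFinset
  have hS : ∀ e t, t ∈ S e ↔ (0 < t ∧ t < Γ.length e) ∧ D (Γ.onEdge e t) ≠ 0 := by
    intro e t
    simp [S]
  refine ⟨S, fun e t ht => ((hS e t).1 ht).1, ?_, ?_⟩
  · intro e t h0 h1 ht
    by_contra hne
    exact ht ((hS e t).2 ⟨⟨h0, h1⟩, by rwa [onEdge_interior e h0 h1]⟩)
  · have hsub : D.support ⊆ Finset.univ.image (Point.vertex : Γ.Vertex → Γ.Point) ∪
        (Finset.univ.biUnion fun e => (S e).image (Γ.onEdge e)) := by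
      intro p hp
      rw [Finsupp.mem_support_iff] at hp
      rw [Finset.mem_union]
      rcases p with v | ⟨e, t, h0, h1⟩
      · left; simp
      · right
        rw [Finset.mem_biUnion]
        refine ⟨e, Finset.mem_univ _, Finset.mem_image.2 ⟨t, ?_, onEdge_interior e h0 h1⟩⟩
        exact (hS e t).2 ⟨⟨h0, h1⟩, by rwa [onEdge_interior e h0 h1]⟩
    rw [Finsupp.sum_of_support_subset D hsub (fun p n => n • κ p) (fun _ _ => zero_smul _ _),
      Finset.sum_union, Finset.sum_image (fun _ _ _ _ h => by simpa using h), Finset.sum_biUnion]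
    · congr 1
      refine Finset.sum_congr rfl fun e _ => ?_
      rw [Finset.sum_image]
      intro s hs t ht h
      exact hinj e ((hS e s).1 hs).1 ((hS e t).1 ht).1 h
    · intro e _ e' _ hne
      rw [Function.onFun, Finset.disjoint_left]
      intro p hp hp'
      obtain ⟨s, hs, rfl⟩ := Finset.mem_image.1 hp
      obtain ⟨t, ht, h⟩ := Finset.mem_image.1 hp'
      have h1 := ((hS _ _).1 hs).1
      have h2 := ((hS _ _).1 ht).1
      rw [onEdge_interior _ h1.1 h1.2, onEdge_interior _ h2.1 h2.2] at h
      exact hne (by injection h with h _; exact h.symm)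
    · rw [Finset.disjoint_left]
      intro p hp hp'
      obtain ⟨v, -, rfl⟩ := Finset.mem_image.1 hp
      obtain ⟨e, -, hp'⟩ := Finset.mem_biUnion.1 hp'
      obtain ⟨t, ht, h⟩ := Finset.mem_image.1 hp'
      have h2 := ((hS _ _).1 ht).1
      rw [onEdge_interior _ h2.1 h2.2] at h
      cases h

/-- Integration by parts: a coordinate function that is linear along the edges, summed over a
principal divisor. -/
theorem RationalFunction.sum_ord_smul {A : Type*} [AddCommGroup A] (f : Γ.RationalFunction)
    {D : Γ.Divisor} (hD : ∀ p, D p = f.ord p) (κ : Γ.Point → A) (ρ : Γ.Edge → ℝ →+ A)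
    (hκ : ∀ e t, 0 ≤ t → t ≤ Γ.length e → κ (Γ.onEdge e t) = κ (Point.vertex (Γ.src e)) + ρ e t) :
    D.sum (fun p n => n • κ p) =
      ∑ e, ρ e (f.toFun (Point.vertex (Γ.src e)) - f.toFun (Point.vertex (Γ.tgt e))) := by
  classical
  obtain ⟨S, hS, hS0, hsum⟩ := sum_eq_sum_vertex_add_sum_edge D κ
  have hv : ∑ v, D (Point.vertex v) • κ (Point.vertex v) =
      ∑ e, (f.fwd e 0 • κ (Point.vertex (Γ.src e)) +
        f.bwd e (Γ.length e) • κ (Point.vertex (Γ.tgt e))) := by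
    simp only [hD, RationalFunction.ord, Finset.sum_smul]
    rw [Finset.sum_comm]
    refine Finset.sum_congr rfl fun e _ => ?_
    simp only [add_smul, ite_smul, zero_smul, Finset.sum_add_distrib, Finset.sum_ite_eq,
      Finset.mem_univ, if_true]
  rw [hsum, hv, ← Finset.sum_add_distrib]
  refine Finset.sum_congr rfl fun e _ => ?_
  have hin : ∀ t, 0 < t → t < Γ.length e → D (Γ.onEdge e t) = f.fwd e t + f.bwd e t := by
    intro t h0 h1
    rw [onEdge_interior e h0 h1, hD]
    rfl
  -- An affine coordinate on the edge sees only the mass and the first moment of the divisor there,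
  -- end slopes included.
  obtain ⟨m0, m1⟩ := piecewise_linear_moments (Γ.length_pos e)
    (h := fun t => f.toFun (Γ.onEdge e t))
    (f.eventually_fwd e) (f.eventually_bwd e) (S e) (hS e) (fun t h0 h1 ht => by
      rw [← hin t h0 h1, onEdge_interior e h0 h1]
      exact hS0 e t h0 h1 ht)
  simp only [onEdge_zero, onEdge_length] at m1
  have e1 : ∑ t ∈ S e, D (Γ.onEdge e t) • κ (Γ.onEdge e t) =
      (∑ t ∈ S e, (f.fwd e t + f.bwd e t)) • κ (Point.vertex (Γ.src e)) +
        ρ e (∑ t ∈ S e, ((f.fwd e t + f.bwd e t : ℤ) : ℝ) * t) := by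
    rw [Finset.sum_smul, map_sum, ← Finset.sum_add_distrib]
    refine Finset.sum_congr rfl fun t ht => ?_
    obtain ⟨h0, h1⟩ := hS e t ht
    rw [hin t h0 h1, hκ e t h0.le h1.le, smul_add, ← zsmul_eq_mul, map_zsmul]
  have e2 : κ (Point.vertex (Γ.tgt e)) = κ (Point.vertex (Γ.src e)) + ρ e (Γ.length e) := by
    rw [← hκ e _ (Γ.length_pos e).le le_rfl, onEdge_length]
  rw [e1, e2, ← m1, map_add, smul_add, ← zsmul_eq_mul, map_zsmul]
  have e3 : ∀ (a b c : ℤ) (x y z : A), a + b + c = 0 →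
      a • x + (b • x + y) + (c • x + z) = y + z := by
    intro a b c x y z h
    have : a • x + (b • x + y) + (c • x + z) = (a + b + c) • x + (y + z) := by
      rw [add_smul, add_smul]; abel
    rw [this, h, zero_smul, zero_add]
  exact e3 _ _ _ _ _ _ m0

theorem deg_apply_eq_sum (D : Γ.Divisor) : Γ.deg D = D.sum (fun _ n => n • (1 : ℤ)) := by
  simp only [smul_eq_mul, mul_one]
  rfl

/-- The degree is the sum of the constant coordinate `1`, whose slope along every edge is zero. -/
theorem deg_eq_zero_of_mem_principal {D : Γ.Divisor} (hD : D ∈ Γ.principal) : Γ.deg D = 0 := by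
  obtain ⟨f, hf⟩ := hD
  rw [deg_apply_eq_sum, f.sum_ord_smul hf (fun _ => 1) (fun _ => 0) (by simp)]
  simp

theorem deg_single (p : Γ.Point) (n : ℤ) : Γ.deg (Finsupp.single p n) = n := by
  simp [deg]

end MetricGraph

/-! ### Gluing rational functions from the edges -/

namespace MetricGraph

variable {Γ : MetricGraph}

/-- The value of a function given on the vertices and on the edges. -/
def gluedValue (φ : Γ.Vertex → ℝ) (h : Γ.Edge → ℝ → ℝ) : Γ.Point → ℝ
  | Point.vertex x => φ x
  | Point.interior e t _ _ => h e t

theorem gluedValue_onEdge {φ : Γ.Vertex → ℝ} {h : Γ.Edge → ℝ → ℝ}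
    (h0 : ∀ e, h e 0 = φ (Γ.src e)) (hL : ∀ e, h e (Γ.length e) = φ (Γ.tgt e))
    (e : Γ.Edge) {t : ℝ} (ht0 : 0 ≤ t) (htL : t ≤ Γ.length e) :
    gluedValue φ h (Γ.onEdge e t) = h e t := by
  rcases ht0.eq_or_lt with rfl | ht0
  · rw [onEdge_zero, h0]; rfl
  · rcases htL.eq_or_lt with rfl | htL
    · rw [onEdge_length, hL]; rfl
    · rw [onEdge_interior e ht0 htL]; rfl

/-- The rational function glued from piecewise linear functions on the edges. -/
def RationalFunction.glue (φ : Γ.Vertex → ℝ) (h : Γ.Edge → ℝ → ℝ) (fw bw : Γ.Edge → ℝ → ℤ)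
    (h0 : ∀ e, h e 0 = φ (Γ.src e)) (hL : ∀ e, h e (Γ.length e) = φ (Γ.tgt e))
    (hf : ∀ e t, ∀ᶠ s in 𝓝[>] (0 : ℝ), h e (t + s) = h e t + (fw e t : ℝ) * s)
    (hb : ∀ e t, ∀ᶠ s in 𝓝[>] (0 : ℝ), h e (t - s) = h e t + (bw e t : ℝ) * s) :
    Γ.RationalFunction where
  toFun := gluedValue φ h
  fwd := fw
  bwd := bw
  eventually_fwd e t ht0 htL := by
    have : ∀ᶠ s in 𝓝[>] (0 : ℝ), s < Γ.length e - t :=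
      eventually_nhdsGT_zero_iff.2 ⟨_, by linarith, fun _ _ h => h⟩
    filter_upwards [hf e t, this, self_mem_nhdsWithin] with s hs hs1 hs0
    have hs0 : (0 : ℝ) < s := hs0
    rw [gluedValue_onEdge h0 hL e ht0 htL.le,
      gluedValue_onEdge h0 hL e (by linarith) (by linarith), hs]
  eventually_bwd e t ht0 htL := by
    have : ∀ᶠ s in 𝓝[>] (0 : ℝ), s < t :=
      eventually_nhdsGT_zero_iff.2 ⟨_, by linarith, fun _ _ h => h⟩
    filter_upwards [hb e t, this, self_mem_nhdsWithin] with s hs hs1 hs0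
    have hs0 : (0 : ℝ) < s := hs0
    rw [gluedValue_onEdge h0 hL e ht0.le htL,
      gluedValue_onEdge h0 hL e (by linarith) (by linarith), hs]

end MetricGraph

/-! ## The tropical theta function of a circle -/

/-- The convex piecewise linear function with slope `⌊x / l⌋` at `x`. -/
noncomputable def circleTheta (l x : ℝ) : ℝ :=
  (⌊x / l⌋ : ℝ) * x - l * ((⌊x / l⌋ : ℝ) * (⌊x / l⌋ + 1)) / 2

theorem circleTheta_eq {l : ℝ} (hl : 0 < l) {x : ℝ} {n : ℤ} (h0 : n * l ≤ x)
    (h1 : x < (n + 1) * l) : circleTheta l x = n * x - l * (n * (n + 1)) / 2 := by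
  have : ⌊x / l⌋ = n := Int.floor_eq_iff.2 ⟨by rwa [le_div_iff₀ hl], by rwa [div_lt_iff₀ hl]⟩
  rw [circleTheta, this]

/-- Quasi-periodicity: the defect is affine in `x`, so it cancels in combinations of translates with
balanced sums of arguments. -/
theorem circleTheta_add_period {l : ℝ} (hl : 0 < l) (x : ℝ) :
    circleTheta l (x + l) = circleTheta l x + x := by
  have : (x + l) / l = x / l + 1 := by field_simp
  rw [circleTheta, circleTheta, this, Int.floor_add_one]
  push_cast
  ring

theorem circleTheta_fwd {l : ℝ} (hl : 0 < l) (x : ℝ) : ∀ᶠ s in 𝓝[>] (0 : ℝ),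
    circleTheta l (x + s) = circleTheta l x + (⌊x / l⌋ : ℝ) * s := by
  have h0 : (⌊x / l⌋ : ℝ) * l ≤ x := (le_div_iff₀ hl).1 (Int.floor_le _)
  have h1 : x < (⌊x / l⌋ + 1 : ℝ) * l := (div_lt_iff₀ hl).1 (Int.lt_floor_add_one _)
  refine eventually_nhdsGT_zero_iff.2 ⟨(⌊x / l⌋ + 1 : ℝ) * l - x, by linarith, fun s hs hs' => ?_⟩
  rw [circleTheta_eq hl h0 h1, circleTheta_eq (n := ⌊x / l⌋) hl (by linarith) (by linarith)]
  ring

theorem circleTheta_bwd {l : ℝ} (hl : 0 < l) (x : ℝ) : ∀ᶠ s in 𝓝[>] (0 : ℝ),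
    circleTheta l (x - s) = circleTheta l x + ((1 - ⌈x / l⌉ : ℤ) : ℝ) * s := by
  obtain ⟨n, hn⟩ : ∃ n, ⌈x / l⌉ = n + 1 := ⟨⌈x / l⌉ - 1, by ring⟩
  have h0 : (n : ℝ) * l < x := by
    have := Int.ceil_lt_add_one (x / l)
    rw [hn] at this
    push_cast at this
    exact (lt_div_iff₀ hl).1 (by linarith)
  have h1 : x ≤ (n + 1 : ℝ) * l := by
    have := Int.le_ceil (x / l)
    rw [hn] at this
    push_cast at this
    exact (div_le_iff₀ hl).1 this
  have key : circleTheta l x = n * x - l * (n * (n + 1)) / 2 := by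
    rcases h1.eq_or_lt with h | h
    · rw [circleTheta_eq (n := n + 1) hl (by push_cast; linarith) (by push_cast; linarith)]
      push_cast
      rw [h]
      ring
    · exact circleTheta_eq hl h0.le h
  refine eventually_nhdsGT_zero_iff.2 ⟨x - n * l, by linarith, fun s hs hs' => ?_⟩
  rw [key, circleTheta_eq (n := n) hl (by linarith) (by linarith), hn]
  push_cast
  ring

open Classical in
-- The left side is the sum of the outgoing slopes of `circleTheta` at `x`: on the circle, the theta
-- function has a single simple zero.
theorem floor_sub_ceil_div {l : ℝ} (hl : 0 < l) (x : ℝ) :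
    ⌊x / l⌋ + (1 - ⌈x / l⌉) = if (x : AddCircle l) = 0 then 1 else 0 := by
  split_ifs with h
  · obtain ⟨n, hn⟩ := (AddCircle.coe_eq_zero_iff l).1 h
    have : x / l = n := by rw [← hn, zsmul_eq_mul]; field_simp
    rw [this]; simp
  · have h1 : (⌊x / l⌋ : ℝ) ≠ x / l := fun hx => h ((AddCircle.coe_eq_zero_iff l).2 ⟨⌊x / l⌋, by
      rw [zsmul_eq_mul, hx]; field_simp⟩)
    have : ⌈x / l⌉ = ⌊x / l⌋ + 1 := by
      rw [Int.ceil_eq_iff]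
      push_cast
      refine ⟨?_, (Int.lt_floor_add_one _).le⟩
      have := lt_of_le_of_ne (Int.floor_le (x / l)) h1
      linarith
    rw [this]; ring

theorem Function.Periodic.eq_of_coe_eq {β : Type*} {l : ℝ} {F : ℝ → β}
    (hF : Function.Periodic F l) {x y : ℝ} (h : (x : AddCircle l) = y) : F x = F y := by
  rw [← sub_eq_zero, ← AddCircle.coe_sub, AddCircle.coe_eq_zero_iff] at h
  obtain ⟨n, hn⟩ := h
  rw [show x = y + n • l by rw [hn]; ring]
  exact hF.zsmul n y

namespace ChainOfCycles

variable {g : ℕ} (C : ChainOfCycles g)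

/-! ## Coordinates on the cycles -/

theorem onEdge_zero (e : C.Edge) :
    C.graph.onEdge e 0 = MetricGraph.Point.vertex (C.src e) :=
  MetricGraph.onEdge_zero (Γ := C.graph) e

theorem onEdge_edgeLength (e : C.Edge) :
    C.graph.onEdge e (C.edgeLength e) = MetricGraph.Point.vertex (C.tgt e) :=
  MetricGraph.onEdge_length (Γ := C.graph) e

/-- The number of cycles to the left of a vertex. -/
def index : C.Vertex → ℕ
  | Vertex.right i => i.val + 1
  | Vertex.start => 0
  | Vertex.left j => j.val.val + 1

theorem index_w (i : Fin g) : C.index (C.w i) = i.val + 1 := rfl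

theorem index_v (i : Fin g) : C.index (C.v i) = i.val := by
  unfold v
  split_ifs with h hb
  · simp [index, h]
  · simp only [index]; omega
  · rw [index_w]; simp only; omega

theorem v_ne_w (i k : Fin g) (h : k ≤ i) : C.v k ≠ C.w i := by
  intro e
  have := congrArg C.index e
  rw [index_v, index_w] at this
  have : k.val ≤ i.val := h
  omega

theorem v_succ_of_open (j : C.OpenBridge) :
    C.v ⟨j.val.val + 1, by omega⟩ = Vertex.left j := by
  have := j.property
  simp [v, this]

theorem v_succ_of_not_open {n : ℕ} (hn : n + 1 < g) (hb : ¬ 0 < C.bridge ⟨n, by omega⟩) :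
    C.v ⟨n + 1, hn⟩ = C.w ⟨n, by omega⟩ := by
  simp [v, hb]

/-- The position of a vertex, relative to `w i`, after contraction of the other cycles. -/
noncomputable def vertexCoord (i : Fin g) (x : C.Vertex) : ℝ :=
  if C.index x ≤ i.val then -C.a i else 0

/-- `1` on the edges of the `i`-th cycle, `0` on the other edges. -/
def speed (i : Fin g) : C.Edge → ℤ
  | Edge.vw k => if k = i then 1 else 0
  | Edge.wv k => if k = i then 1 else 0
  | Edge.link _ => 0

/-- The position of a point, relative to `w i`, after contraction of everything but the `i`-th
cycle. -/
noncomputable def coord (i : Fin g) : C.graph.Point → ℝ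
  | MetricGraph.Point.vertex x => C.vertexCoord i x
  | MetricGraph.Point.interior e t _ _ => C.vertexCoord i (C.src e) + C.speed i e * t

theorem vertexCoord_v (i k : Fin g) :
    C.vertexCoord i (C.v k) = if k ≤ i then -C.a i else 0 := by
  simp [vertexCoord, index_v]

theorem vertexCoord_w (i k : Fin g) :
    C.vertexCoord i (C.w k) = if k < i then -C.a i else 0 := by
  simp only [vertexCoord, index_w, Nat.succ_le_iff, Fin.lt_def]

/-- Only the edge from `w i` back to `v i` needs the reduction modulo the length: it runs from `0`
to `b i`, which is `-a i` after one turn. -/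
theorem coe_vertexCoord_tgt (i : Fin g) (e : C.Edge) :
    ((C.vertexCoord i (C.tgt e) : ℝ) : AddCircle (C.cycleLength i)) =
      ((C.vertexCoord i (C.src e) + C.speed i e * C.edgeLength e : ℝ) :
        AddCircle (C.cycleLength i)) := by
  rw [← sub_eq_zero, ← AddCircle.coe_sub, AddCircle.coe_eq_zero_iff]
  rcases e with k | k | j
  · refine ⟨0, ?_⟩
    simp only [tgt, src, vertexCoord_v, vertexCoord_w, speed, edgeLength]
    rcases lt_trichotomy k i with h | rfl | h
    · simp [h, h.le, h.ne]
    · simp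
    · simp [h.not_ge, h.not_gt, h.ne']
  · simp only [tgt, src, vertexCoord_v, vertexCoord_w, speed, edgeLength]
    rcases lt_trichotomy k i with h | rfl | h
    · exact ⟨0, by simp [h, h.le, h.ne]⟩
    · exact ⟨-1, by simp [cycleLength]; ring⟩
    · exact ⟨0, by simp [h.not_ge, h.not_gt, h.ne']⟩
  · refine ⟨0, ?_⟩
    simp [tgt, src, vertexCoord, index_v, index_w, speed]

theorem coe_coord_onEdge (i : Fin g) (e : C.Edge) {t : ℝ} (h0 : 0 ≤ t)
    (h1 : t ≤ C.edgeLength e) :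
    ((C.coord i (C.graph.onEdge e t) : ℝ) : AddCircle (C.cycleLength i)) =
      ((C.vertexCoord i (C.src e) + C.speed i e * t : ℝ) : AddCircle (C.cycleLength i)) := by
  rcases h0.eq_or_lt with rfl | h0
  · rw [onEdge_zero]
    simp [coord]
  · rcases h1.eq_or_lt with rfl | h1
    · rw [← C.coe_vertexCoord_tgt, onEdge_edgeLength]
      rfl
    · rw [MetricGraph.onEdge_interior (Γ := C.graph) e h0 h1]
      rfl

/-- The Abel–Jacobi coordinate of a divisor on the `i`-th cycle. -/
noncomputable def aj (i : Fin g) : C.graph.Divisor →+ AddCircle (C.cycleLength i) :=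
  Finsupp.liftAddHom fun p =>
    zmultiplesHom (AddCircle (C.cycleLength i)) (C.coord i p : AddCircle (C.cycleLength i))

theorem aj_single (i : Fin g) (p : C.graph.Point) (n : ℤ) :
    C.aj i (Finsupp.single p n) = n • (C.coord i p : AddCircle (C.cycleLength i)) := by
  simp [aj]

theorem aj_apply (i : Fin g) (D : C.graph.Divisor) :
    C.aj i D = D.sum fun p n => n • (C.coord i p : AddCircle (C.cycleLength i)) := by
  rfl

theorem sum_speed_smul {A : Type*} [AddCommGroup A] (i : Fin g) (G : C.Edge → A) :
    ∑ e : C.graph.Edge, C.speed i e • G e = G (Edge.vw i) + G (Edge.wv i) := by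
  refine (Finset.sum_eq_add (ι := C.graph.Edge) (Edge.vw i : C.Edge) (Edge.wv i : C.Edge)
    (fun h => by cases h) ?_ ?_ ?_).trans ?_
  · rintro (k | k | j) - ⟨h1, h2⟩
    · rw [speed, if_neg (fun h => h1 (by rw [h])), zero_smul]
    · rw [speed, if_neg (fun h => h2 (by rw [h])), zero_smul]
    · rw [speed, zero_smul]
  · intro h; exact absurd (Finset.mem_univ _) h
  · intro h; exact absurd (Finset.mem_univ _) h
  · simp [speed]

/-- Only the two edges of cycle `i` have nonzero speed, and the differences of `f` along them cancel
around the cycle. -/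
theorem aj_eq_zero_of_mem_principal (i : Fin g) {D : C.graph.Divisor}
    (hD : D ∈ C.graph.principal) : C.aj i D = 0 := by
  obtain ⟨f, hf⟩ := hD
  let q : ℝ →+ AddCircle (C.cycleLength i) := QuotientAddGroup.mk' _
  rw [aj_apply, f.sum_ord_smul hf (fun p => (C.coord i p : AddCircle (C.cycleLength i)))
    (fun e => C.speed i e • q)]
  · have := C.sum_speed_smul i (fun e => q (f.toFun (MetricGraph.Point.vertex (C.src e)) -
      f.toFun (MetricGraph.Point.vertex (C.tgt e))))
    refine this.trans ?_
    rw [← map_add]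
    simp [src, tgt]
  · intro e t h0 h1
    rw [C.coe_coord_onEdge i e h0 h1, AddCircle.coe_add, ← zsmul_eq_mul]
    rfl

/-! ## Principal divisors supported on a cycle -/

open Classical in
/-- `1` on the points of the `i`-th cycle, `0` elsewhere. -/
noncomputable def onCycle (i : Fin g) : C.graph.Point → ℤ
  | MetricGraph.Point.vertex x => (if C.v i = x then 1 else 0) + (if C.w i = x then 1 else 0)
  | MetricGraph.Point.interior e _ _ _ => C.speed i e

/-- A piecewise linear function on a circle gives a rational function on the chain, constant off
the cycle. -/
theorem exists_rationalFunction_of_periodic (i : Fin g) {F : ℝ → ℝ} {fw bw : ℝ → ℤ}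
    (hF : Function.Periodic F (C.cycleLength i)) (hbw : Function.Periodic bw (C.cycleLength i))
    (hf : ∀ t, ∀ᶠ s in 𝓝[>] (0 : ℝ), F (t + s) = F t + (fw t : ℝ) * s)
    (hb : ∀ t, ∀ᶠ s in 𝓝[>] (0 : ℝ), F (t - s) = F t + (bw t : ℝ) * s) :
    ∃ f : C.graph.RationalFunction, ∀ p,
      f.ord p = C.onCycle i p * (fw (C.coord i p) + bw (C.coord i p)) := by
  classical
  have hs : ∀ e, C.speed i e = 0 ∨ C.speed i e = 1 := by
    rintro (k | k | j) <;> simp only [speed]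
    · split_ifs <;> simp
    · split_ifs <;> simp
    · simp
  let pos : C.Edge → ℝ → ℝ := fun e t => C.vertexCoord i (C.src e) + C.speed i e * t
  refine ⟨MetricGraph.RationalFunction.glue (Γ := C.graph) (fun x => F (C.vertexCoord i x))
    (fun e t => F (pos e t)) (fun e t => C.speed i e * fw (pos e t))
    (fun e t => C.speed i e * bw (pos e t)) ?_ ?_ ?_ ?_, ?_⟩
  · intro e
    simp only [pos, mul_zero, add_zero]
    rfl
  · intro e
    exact hF.eq_of_coe_eq (C.coe_vertexCoord_tgt i e).symm
  · intro e t
    rcases hs e with h | h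
    · simp [pos, h]
    · filter_upwards [hf (pos e t)] with s hs
      simp only [pos, h, Int.cast_one, one_mul] at hs ⊢
      rw [← add_assoc, hs]
  · intro e t
    rcases hs e with h | h
    · simp [pos, h]
    · filter_upwards [hb (pos e t)] with s hs
      simp only [pos, h, Int.cast_one, one_mul] at hs ⊢
      rw [← add_sub_assoc, hs]
  · rintro (x | ⟨e, t, h0, h1⟩)
    · revert x
      intro (x : C.Vertex)
      have h1 := C.sum_speed_smul i (fun e => (if C.src e = x then fw (C.vertexCoord i x) else 0) +
        (if C.tgt e = x then bw (C.vertexCoord i x) else 0))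
      have h2 : ∀ e, (if C.tgt e = x then C.speed i e * bw (pos e (C.edgeLength e)) else 0) =
          C.speed i e * if C.tgt e = x then bw (C.vertexCoord i x) else 0 := by
        intro e
        split_ifs with h
        · rw [← h]
          congr 1
          exact hbw.eq_of_coe_eq (C.coe_vertexCoord_tgt i e).symm
        · rw [mul_zero]
      have h3 : ∀ e, (if C.src e = x then C.speed i e * fw (pos e 0) else 0) =
          C.speed i e * if C.src e = x then fw (C.vertexCoord i x) else 0 := by
        intro e
        split_ifs with h
        · rw [← h]
          simp [pos]
        · rw [mul_zero]
      refine Eq.trans (Finset.sum_congr rfl fun e _ => ?_) (h1.trans ?_)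
      · exact (congrArg₂ (· + ·) (h3 e) (h2 e)).trans (mul_add _ _ _).symm
      · simp only [src, tgt, onCycle, coord]
        by_cases hv : C.v i = x <;> by_cases hw : C.w i = x <;> simp only [hv, hw] <;> simp <;> ring
    · change C.speed i e * fw (pos e t) + C.speed i e * bw (pos e t) =
        C.speed i e * (fw (pos e t) + bw (pos e t))
      ring

/-- The point of the `i`-th cycle at clockwise distance `u` from `w i`. -/
noncomputable def cyc (i : Fin g) (u : ℝ) : C.graph.Point :=
  if toIcoMod (C.cycleLength_pos i) 0 u ≤ C.b i then
    C.graph.onEdge (Edge.wv i) (toIcoMod (C.cycleLength_pos i) 0 u)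
  else C.graph.onEdge (Edge.vw i) (toIcoMod (C.cycleLength_pos i) 0 u - C.b i)

theorem cyclePoint_eq_cyc (i : Fin g) (ξ : ℝ) : C.cyclePoint i ξ = C.cyc i (ξ * C.a i) := rfl

theorem cyc_periodic (i : Fin g) : Function.Periodic (C.cyc i) (C.cycleLength i) := by
  intro u
  simp only [cyc, toIcoMod_add_right]

theorem cyc_eq (i : Fin g) {u s : ℝ} (h0 : 0 ≤ s) (h1 : s < C.cycleLength i)
    (h : (u : AddCircle (C.cycleLength i)) = s) :
    C.cyc i u = if s ≤ C.b i then C.graph.onEdge (Edge.wv i) s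
      else C.graph.onEdge (Edge.vw i) (s - C.b i) := by
  rw [(C.cyc_periodic i).eq_of_coe_eq h]
  have : toIcoMod (C.cycleLength_pos i) 0 s = s :=
    (toIcoMod_eq_self _).2 ⟨h0, by simpa using h1⟩
  rw [cyc, this]

theorem exists_reduced (i : Fin g) (u : ℝ) : ∃ s : ℝ, 0 ≤ s ∧ s < C.cycleLength i ∧
    (u : AddCircle (C.cycleLength i)) = s := by
  have h := toIcoMod_mem_Ico (C.cycleLength_pos i) 0 u
  refine ⟨toIcoMod (C.cycleLength_pos i) 0 u, h.1, by simpa using h.2, ?_⟩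
  rw [← sub_eq_zero, ← AddCircle.coe_sub, AddCircle.coe_eq_zero_iff]
  refine ⟨toIcoDiv (C.cycleLength_pos i) 0 u, ?_⟩
  have := toIcoMod_add_toIcoDiv_zsmul (C.cycleLength_pos i) 0 u
  linarith

theorem cyc_zero (i : Fin g) : C.cyc i 0 = MetricGraph.Point.vertex (C.w i) := by
  rw [C.cyc_eq i le_rfl (C.cycleLength_pos i) rfl, if_pos (C.b_pos i).le, onEdge_zero]
  rfl

theorem coe_neg_a (i : Fin g) :
    ((-C.a i : ℝ) : AddCircle (C.cycleLength i)) = (C.b i : ℝ) := by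
  rw [← sub_eq_zero, ← AddCircle.coe_sub, AddCircle.coe_eq_zero_iff]
  exact ⟨-1, by simp [cycleLength]; ring⟩

theorem cyc_neg_a (i : Fin g) : C.cyc i (-C.a i) = MetricGraph.Point.vertex (C.v i) := by
  have := C.a_pos i
  rw [C.cyc_eq i (C.b_pos i).le (by rw [cycleLength]; linarith) (C.coe_neg_a i), if_pos le_rfl]
  exact C.onEdge_edgeLength (Edge.wv i)

theorem cyc_of_wv (i : Fin g) {t : ℝ} (h0 : 0 < t) (h1 : t < C.b i) :
    C.cyc i t = MetricGraph.Point.interior (Γ := C.graph) (Edge.wv i : C.Edge) t h0 h1 := by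
  have := C.a_pos i
  rw [C.cyc_eq i h0.le (by rw [cycleLength]; linarith) rfl, if_pos h1.le]
  exact MetricGraph.onEdge_interior (Γ := C.graph) (Edge.wv i : C.Edge) h0 h1

theorem cyc_of_vw (i : Fin g) {t : ℝ} (h0 : 0 < t) (h1 : t < C.a i) :
    C.cyc i (-C.a i + t) =
      MetricGraph.Point.interior (Γ := C.graph) (Edge.vw i : C.Edge) t h0 h1 := by
  have := C.b_pos i
  rw [C.cyc_eq (s := C.b i + t) i (by linarith) (by rw [cycleLength]; linarith)
    (by rw [AddCircle.coe_add, coe_neg_a, AddCircle.coe_add]), if_neg (by linarith),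
    add_sub_cancel_left]
  exact MetricGraph.onEdge_interior (Γ := C.graph) (Edge.vw i : C.Edge) h0 h1

theorem exists_cyc_eq (i : Fin g) (u : ℝ) :
    C.cyc i u = MetricGraph.Point.vertex (C.w i) ∧ (u : AddCircle (C.cycleLength i)) = 0 ∨
    C.cyc i u = MetricGraph.Point.vertex (C.v i) ∧
      (u : AddCircle (C.cycleLength i)) = (-C.a i : ℝ) ∨
    (∃ t h0 h1, C.cyc i u =
      MetricGraph.Point.interior (Γ := C.graph) (Edge.wv i : C.Edge) t h0 h1 ∧
      (u : AddCircle (C.cycleLength i)) = t) ∨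
    (∃ t h0 h1, C.cyc i u =
      MetricGraph.Point.interior (Γ := C.graph) (Edge.vw i : C.Edge) t h0 h1 ∧
      (u : AddCircle (C.cycleLength i)) = (-C.a i + t : ℝ)) := by
  obtain ⟨s, h0, h1, hs⟩ := C.exists_reduced i u
  rw [(C.cyc_periodic i).eq_of_coe_eq hs, hs]
  rcases h0.eq_or_lt with rfl | h0
  · exact Or.inl ⟨C.cyc_zero i, rfl⟩
  · rcases lt_trichotomy s (C.b i) with h | h | h
    · exact Or.inr (Or.inr (Or.inl ⟨s, h0, h, C.cyc_of_wv i h0 h, rfl⟩))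
    · refine Or.inr (Or.inl ⟨?_, ?_⟩)
      · rw [← C.cyc_neg_a]
        exact (C.cyc_periodic i).eq_of_coe_eq (by rw [coe_neg_a, h])
      · rw [coe_neg_a, h]
    · have ha : s - C.b i < C.a i := by
        rw [cycleLength] at h1
        linarith
      have e : (s : AddCircle (C.cycleLength i)) = (-C.a i + (s - C.b i) : ℝ) := by
        rw [AddCircle.coe_add, coe_neg_a, ← AddCircle.coe_add, add_sub_cancel]
      refine Or.inr (Or.inr (Or.inr ⟨s - C.b i, by linarith, ha, ?_, e⟩))
      rw [← C.cyc_of_vw i (by linarith) ha]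
      exact (C.cyc_periodic i).eq_of_coe_eq e

theorem onCycle_cyc (i : Fin g) (u : ℝ) : C.onCycle i (C.cyc i u) = 1 := by
  have := C.v_ne_w i i le_rfl
  rcases C.exists_cyc_eq i u with ⟨h, -⟩ | ⟨h, -⟩ | ⟨t, h0, h1, h, -⟩ | ⟨t, h0, h1, h, -⟩ <;>
    rw [h]
  · simp [onCycle, this]
  · simp [onCycle, this.symm]
  · simp [onCycle, speed]
  · simp [onCycle, speed]

theorem coe_coord_cyc (i k : Fin g) (u : ℝ) :
    ((C.coord i (C.cyc k u) : ℝ) : AddCircle (C.cycleLength i)) =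
      if k = i then (u : AddCircle (C.cycleLength i))
      else if k < i then ((-C.a i : ℝ) : AddCircle (C.cycleLength i)) else 0 := by
  split_ifs with hki hki'
  · subst hki
    rcases C.exists_cyc_eq k u with ⟨h, e⟩ | ⟨h, e⟩ | ⟨t, h0, h1, h, e⟩ | ⟨t, h0, h1, h, e⟩ <;>
      rw [h, e]
    · simp [coord, vertexCoord_w]
    · simp [coord, vertexCoord_v]
    · simp [coord, vertexCoord_w, src, speed]
    · simp [coord, vertexCoord_v, src, speed]
  · congr 1
    rcases C.exists_cyc_eq k u with ⟨h, -⟩ | ⟨h, -⟩ | ⟨t, h0, h1, h, -⟩ | ⟨t, h0, h1, h, -⟩ <;>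
      rw [h]
    · simp [coord, vertexCoord_w, hki']
    · simp [coord, vertexCoord_v, hki'.le]
    · simp [coord, vertexCoord_w, src, speed, hki', hki]
    · simp [coord, vertexCoord_v, src, speed, hki'.le, hki]
  · have hlt : i < k := lt_of_le_of_ne (not_lt.1 hki') (Ne.symm hki)
    rw [show (0 : AddCircle (C.cycleLength i)) = ((0 : ℝ) : AddCircle (C.cycleLength i)) from rfl]
    congr 1
    rcases C.exists_cyc_eq k u with ⟨h, -⟩ | ⟨h, -⟩ | ⟨t, h0, h1, h, -⟩ | ⟨t, h0, h1, h, -⟩ <;>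
      rw [h]
    · simp [coord, vertexCoord_w, hki']
    · simp [coord, vertexCoord_v, hlt]
    · simp [coord, vertexCoord_w, src, speed, hki', hki]
    · simp [coord, vertexCoord_v, src, speed, hlt, hki]

theorem cyc_coord (i : Fin g) {p : C.graph.Point} (hp : C.onCycle i p ≠ 0) :
    C.cyc i (C.coord i p) = p := by
  classical
  rcases p with x | ⟨(k | k | j), t, h0, h1⟩
  · by_cases hv : C.v i = x
    · subst hv
      simp only [coord, vertexCoord_v, le_refl, if_true]
      exact C.cyc_neg_a i
    · by_cases hw : C.w i = x
      · subst hw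
        simp only [coord, vertexCoord_w, lt_irrefl, if_false]
        exact C.cyc_zero i
      · simp [onCycle, hv, hw] at hp
  · have hk : k = i := by
      by_contra hk
      simp [onCycle, speed, hk] at hp
    subst hk
    simp only [coord, src, vertexCoord_v, le_refl, if_true, speed, Int.cast_one, one_mul]
    exact C.cyc_of_vw k h0 h1
  · have hk : k = i := by
      by_contra hk
      simp [onCycle, speed, hk] at hp
    subst hk
    simp only [coord, src, vertexCoord_w, lt_irrefl, if_false, if_true, speed, Int.cast_one,
      one_mul, zero_add]
    exact C.cyc_of_wv k h0 h1
  · simp [onCycle, speed] at hp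

open Classical in
-- Brings a point divisor into the form in which `exists_rationalFunction_of_periodic` gives orders.
theorem single_cyc_apply (i : Fin g) (u : ℝ) (p : C.graph.Point) :
    (Finsupp.single (C.cyc i u) 1 : C.graph.Divisor) p =
      C.onCycle i p * if ((C.coord i p : ℝ) : AddCircle (C.cycleLength i)) = u then 1 else 0 := by
  rw [Finsupp.single_apply]
  split_ifs with h h' h'
  · rw [← h, onCycle_cyc, mul_one]
  · exact absurd (by rw [← h, coe_coord_cyc, if_pos rfl]) h'
  · have : C.onCycle i p = 0 := by
      by_contra hne
      exact h (by rw [← (C.cyc_periodic i).eq_of_coe_eq h', C.cyc_coord i hne])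
    rw [this, zero_mul]
  · rw [mul_zero]

/-- The function `θ(x-s) + θ(x-t) - θ(x-s-t) - θ(x)` has the required zeros and poles. It is
periodic because its defect is `(x-s) + (x-t) - (x-s-t) - x = 0`. -/
theorem single_cyc_add_mem_principal (i : Fin g) (s t : ℝ) :
    (Finsupp.single (C.cyc i s) 1 + Finsupp.single (C.cyc i t) 1
      - Finsupp.single (C.cyc i (s + t)) 1 - Finsupp.single (C.cyc i 0) 1 : C.graph.Divisor) ∈
      C.graph.principal := by
  classical
  have hl := C.cycleLength_pos i
  set l := C.cycleLength i with hl_def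
  have hper : ∀ x u : ℝ, (x + l - u) / l = (x - u) / l + 1 := by
    intro x u; field_simp; ring
  have key := C.exists_rationalFunction_of_periodic i
    (F := fun x => circleTheta l (x - s) + circleTheta l (x - t) - circleTheta l (x - (s + t))
      - circleTheta l (x - 0))
    (fw := fun x => ⌊(x - s) / l⌋ + ⌊(x - t) / l⌋ - ⌊(x - (s + t)) / l⌋ - ⌊(x - 0) / l⌋)
    (bw := fun x => (1 - ⌈(x - s) / l⌉) + (1 - ⌈(x - t) / l⌉) - (1 - ⌈(x - (s + t)) / l⌉)
      - (1 - ⌈(x - 0) / l⌉)) ?_ ?_ ?_ ?_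
  · obtain ⟨f, hf⟩ := key
    refine ⟨f, fun p => ?_⟩
    rw [hf]
    have e : ∀ u : ℝ, (if ((C.coord i p : ℝ) : AddCircle l) = u then (1 : ℤ) else 0) =
        ⌊(C.coord i p - u) / l⌋ + (1 - ⌈(C.coord i p - u) / l⌉) := by
      intro u
      rw [floor_sub_ceil_div hl, AddCircle.coe_sub]
      simp only [sub_eq_zero]
    rw [Finsupp.sub_apply, Finsupp.sub_apply, Finsupp.add_apply, single_cyc_apply,
      single_cyc_apply, single_cyc_apply, single_cyc_apply, ← hl_def, e, e, e, e]
    ring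
  · intro x
    simp only [← hl_def, add_sub_right_comm x l, circleTheta_add_period hl]
    ring
  · intro x
    simp only [← hl_def, hper, Int.ceil_add_one]
    ring
  · intro x
    filter_upwards [circleTheta_fwd hl (x - s), circleTheta_fwd hl (x - t),
      circleTheta_fwd hl (x - (s + t)), circleTheta_fwd hl (x - 0)] with r h1 h2 h3 h4
    simp only [add_sub_right_comm x r, h1, h2, h3, h4]
    push_cast
    ring
  · intro x
    filter_upwards [circleTheta_bwd hl (x - s), circleTheta_bwd hl (x - t),
      circleTheta_bwd hl (x - (s + t)), circleTheta_bwd hl (x - 0)] with r h1 h2 h3 h4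
    simp only [sub_right_comm x r, h1, h2, h3, h4]
    push_cast
    ring

end ChainOfCycles

namespace ChainOfCycles

variable {g : ℕ} (C : ChainOfCycles g)

/-! ## Bridges -/

theorem left_ne_w (j : C.OpenBridge) (i : Fin g) : (Vertex.left j : C.Vertex) ≠ C.w i := by
  intro h; cases h

/-- A vertex is to the right of an open bridge. -/
def RightOf (j : C.OpenBridge) (x : C.Vertex) : Prop :=
  j.val.val + 1 < C.index x ∨ x = Vertex.left j

theorem rightOf_v (j : C.OpenBridge) (i : Fin g) : C.RightOf j (C.v i) ↔ j.val.val < i.val := by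
  rw [RightOf, index_v]
  constructor
  · rintro (h | h)
    · omega
    · have := congrArg C.index h
      rw [index_v] at this
      simp only [index] at this
      omega
  · intro h
    by_cases h' : j.val.val + 1 < i.val
    · exact Or.inl h'
    · right
      rw [← C.v_succ_of_open j]
      congr 1
      ext
      simp only
      omega

theorem rightOf_w (j : C.OpenBridge) (i : Fin g) : C.RightOf j (C.w i) ↔ j.val.val < i.val := by
  rw [RightOf, index_w]
  have := C.left_ne_w j i
  constructor
  · rintro (h | h)
    · omega
    · exact absurd h.symm this
  · intro h
    left; omega

theorem rightOf_tgt_iff (j : C.OpenBridge) (e : C.Edge) (he : e ≠ Edge.link j) :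
    C.RightOf j (C.tgt e) ↔ C.RightOf j (C.src e) := by
  rcases e with i | i | k
  · rw [tgt, src, rightOf_v, rightOf_w]
  · rw [tgt, src, rightOf_v, rightOf_w]
  · have hk : k.val.val ≠ j.val.val := fun h => he (by
      congr 1
      exact Subtype.ext (Fin.ext h))
    rw [tgt, src, rightOf_v, rightOf_w]
    simp only
    omega

/-- A bridge disconnects the chain. So a function may vanish to its left, climb with slope one up to
distance `u` along the bridge, and keep the value `u` from there on. -/
theorem single_bridge_sub_mem_principal (j : C.OpenBridge) {u : ℝ} (h0 : 0 < u)
    (h1 : u ≤ C.bridge j.val) :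
    (Finsupp.single (MetricGraph.Point.vertex (C.src (Edge.link j))) 1
      - Finsupp.single (C.graph.onEdge (Edge.link j : C.Edge) u) 1 : C.graph.Divisor) ∈
      C.graph.principal := by
  classical
  let φ : C.Vertex → ℝ := fun x => if C.RightOf j x then u else 0
  have hsrc : φ (C.src (Edge.link j)) = 0 := by
    simp only [φ]
    rw [if_neg]
    rw [src, rightOf_w]
    exact lt_irrefl _
  have htgt : φ (C.tgt (Edge.link j)) = u := by
    simp only [φ]
    rw [if_pos]
    rw [tgt, rightOf_v]
    exact Nat.lt_succ_self _
  let h : C.Edge → ℝ → ℝ := fun e t => if e = Edge.link j then min t u else φ (C.src e)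
  let fw : C.Edge → ℝ → ℤ := fun e t => if e = Edge.link j then (if t < u then 1 else 0) else 0
  let bw : C.Edge → ℝ → ℤ := fun e t => if e = Edge.link j then (if t ≤ u then -1 else 0) else 0
  have e0 : ∀ e, h e 0 = φ (C.src e) := by
    intro e
    simp only [h]
    split_ifs with he
    · rw [he, hsrc, min_eq_left h0.le]
    · rfl
  have eL : ∀ e, h e (C.edgeLength e) = φ (C.tgt e) := by
    intro e
    simp only [h]
    split_ifs with he
    · rw [he, htgt, edgeLength, min_eq_right h1]
    · simp only [φ, C.rightOf_tgt_iff j e he]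
  have hf : ∀ e t, ∀ᶠ s in 𝓝[>] (0 : ℝ), h e (t + s) = h e t + (fw e t : ℝ) * s := by
    intro e t
    simp only [h, fw]
    by_cases he : e = Edge.link j
    · simp only [he, if_true]
      rw [eventually_nhdsGT_zero_iff]
      by_cases ht : t < u
      · refine ⟨u - t, by linarith, fun s hs hs' => ?_⟩
        rw [min_eq_left (by linarith), min_eq_left ht.le, if_pos ht]
        simp
      · refine ⟨1, one_pos, fun s hs hs' => ?_⟩
        rw [min_eq_right (by linarith), min_eq_right (by linarith), if_neg ht]
        simp
    · simp [he]
  have hb : ∀ e t, ∀ᶠ s in 𝓝[>] (0 : ℝ), h e (t - s) = h e t + (bw e t : ℝ) * s := by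
    intro e t
    simp only [h, bw]
    by_cases he : e = Edge.link j
    · simp only [he, if_true]
      rw [eventually_nhdsGT_zero_iff]
      by_cases ht : t ≤ u
      · refine ⟨1, one_pos, fun s hs hs' => ?_⟩
        rw [min_eq_left (by linarith), min_eq_left ht, if_pos ht]
        simp
        ring
      · refine ⟨t - u, by linarith, fun s hs hs' => ?_⟩
        rw [min_eq_right (by linarith), min_eq_right (by linarith), if_neg ht]
        simp
    · simp [he]
  refine ⟨MetricGraph.RationalFunction.glue (Γ := C.graph) φ h fw bw e0 eL hf hb, ?_⟩
  rintro (x | ⟨e, t, ht0, ht1⟩)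
  · revert x
    intro (x : C.Vertex)
    have hsum : (MetricGraph.RationalFunction.glue (Γ := C.graph) φ h fw bw e0 eL hf hb).ord
        (MetricGraph.Point.vertex x) =
        (if C.src (Edge.link j) = x then fw (Edge.link j) 0 else 0) +
        (if C.tgt (Edge.link j) = x then bw (Edge.link j) (C.bridge j.val) else 0) := by
      refine Finset.sum_eq_single (ι := C.graph.Edge) (Edge.link j : C.Edge) ?_ ?_
      · intro e _ he
        have h1 : fw e 0 = 0 := if_neg he
        have h2 : bw e (C.edgeLength e) = 0 := if_neg he
        change (if C.src e = x then fw e 0 else 0) +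
          (if C.tgt e = x then bw e (C.edgeLength e) else 0) = 0
        rw [h1, h2]
        simp
      · intro h; exact absurd (Finset.mem_univ _) h
    rw [hsum, Finsupp.sub_apply, Finsupp.single_apply, Finsupp.single_apply]
    have hfw : fw (Edge.link j) 0 = 1 := by simp [fw, h0]
    have hv : (MetricGraph.Point.vertex (C.src (Edge.link j)) : C.graph.Point) =
        MetricGraph.Point.vertex x ↔ C.src (Edge.link j) = x :=
      ⟨fun h => by injection h, fun h => by rw [h]⟩
    rw [hfw]
    simp only [hv]
    rcases h1.eq_or_lt with rfl | h1
    · have hbw : bw (Edge.link j) (C.bridge j.val) = -1 := by simp [bw]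
      have hw : (MetricGraph.Point.vertex (C.tgt (Edge.link j)) : C.graph.Point) =
          MetricGraph.Point.vertex x ↔ C.tgt (Edge.link j) = x :=
        ⟨fun h => by injection h, fun h => by rw [h]⟩
      rw [hbw]
      have := C.onEdge_edgeLength (Edge.link j)
      rw [edgeLength] at this
      rw [this]
      simp only [hw]
      by_cases hx : C.tgt (Edge.link j) = x <;> simp [hx]
      ring
    · have hbw : bw (Edge.link j) (C.bridge j.val) = 0 := by simp [bw, h1]
      rw [hbw, MetricGraph.onEdge_interior (Γ := C.graph) (Edge.link j : C.Edge) h0 h1]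
      simp
  · change _ = fw e t + bw e t
    rw [Finsupp.sub_apply, Finsupp.single_apply, Finsupp.single_apply]
    rw [if_neg (by intro h; cases h)]
    revert e
    intro (e : C.Edge) ht1
    by_cases he : e = Edge.link j
    · subst he
      rcases h1.eq_or_lt with rfl | h1
      · have := C.onEdge_edgeLength (Edge.link j)
        rw [edgeLength] at this
        rw [this, if_neg (by intro h; cases h)]
        have ht1 : t < C.bridge j.val := ht1
        simp [fw, bw, ht1, ht1.le]
      · rw [MetricGraph.onEdge_interior (Γ := C.graph) (Edge.link j : C.Edge) h0 h1]
        have : (MetricGraph.Point.interior (Edge.link j : C.Edge) u h0 h1 : C.graph.Point) =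
          MetricGraph.Point.interior (Edge.link j : C.Edge) t ht0 ht1 ↔ u = t :=
          ⟨fun h => by injection h, fun h => by subst h; rfl⟩
        simp only [this, fw, bw, if_true]
        rcases lt_trichotomy t u with h | h | h
        · simp [h, h.le, h.ne']
        · simp [h]
        · simp [h.not_gt, h.not_ge, h.ne]
    · have h1 : fw e t = 0 := if_neg he
      have h2 : bw e t = 0 := if_neg he
      rw [h1, h2, if_neg]
      · rfl
      · intro h
        rcases ‹u ≤ C.bridge j.val›.eq_or_lt with rfl | h1
        · have := C.onEdge_edgeLength (Edge.link j)
          rw [edgeLength] at this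
          rw [this] at h
          cases h
        · rw [MetricGraph.onEdge_interior (Γ := C.graph) (Edge.link j : C.Edge) h0 h1] at h
          injection h with h
          exact he h.symm

/-! ## The Abel–Jacobi theorem -/

/-- The class of a point in the Picard group. -/
noncomputable def cls (p : C.graph.Point) : C.graph.Divisor ⧸ C.graph.principal :=
  QuotientAddGroup.mk (Finsupp.single p 1)

theorem cls_eq_iff {p q : C.graph.Point} : C.cls p = C.cls q ↔
    (Finsupp.single q 1 - Finsupp.single p 1 : C.graph.Divisor) ∈ C.graph.principal := by
  rw [cls, cls, QuotientAddGroup.eq, neg_add_eq_sub]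

/-- Translation along a cycle, as a homomorphism from the circle to the Picard group. -/
noncomputable def shift (i : Fin g) :
    AddCircle (C.cycleLength i) →+ C.graph.Divisor ⧸ C.graph.principal :=
  QuotientAddGroup.lift _ (AddMonoidHom.mk' (fun u : ℝ => C.cls (C.cyc i u) - C.cls (C.cyc i 0))
    (by
      intro s t
      have h : C.cls (C.cyc i s) + C.cls (C.cyc i t) - C.cls (C.cyc i (s + t))
          - C.cls (C.cyc i 0) = 0 :=
        (QuotientAddGroup.eq_zero_iff _).2 (C.single_cyc_add_mem_principal i s t)
      rw [← sub_eq_zero, ← neg_eq_zero, ← h]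
      abel))
    (by
      rintro _ ⟨n, rfl⟩
      rw [AddMonoidHom.mem_ker, AddMonoidHom.mk'_apply, sub_eq_zero]
      congr 1
      exact (C.cyc_periodic i).eq_of_coe_eq ((AddCircle.coe_eq_zero_iff _).2 ⟨n, rfl⟩))

theorem cls_cyc (i : Fin g) (u : ℝ) : C.cls (C.cyc i u) =
    C.cls (MetricGraph.Point.vertex (C.w i)) + C.shift i (u : AddCircle (C.cycleLength i)) := by
  have : C.shift i (u : AddCircle (C.cycleLength i)) =
    C.cls (C.cyc i u) - C.cls (C.cyc i 0) := rfl
  rw [this, cyc_zero]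
  abel

theorem cls_v (i : Fin g) : C.cls (MetricGraph.Point.vertex (C.v i)) =
    C.cls (MetricGraph.Point.vertex (C.w i)) +
      C.shift i ((-C.a i : ℝ) : AddCircle (C.cycleLength i)) := by
  rw [← cls_cyc, cyc_neg_a]

theorem cls_bridge (j : C.OpenBridge) {u : ℝ} (h0 : 0 < u) (h1 : u ≤ C.bridge j.val) :
    C.cls (C.graph.onEdge (Edge.link j : C.Edge) u) =
      C.cls (MetricGraph.Point.vertex (C.src (Edge.link j))) :=
  C.cls_eq_iff.2 (C.single_bridge_sub_mem_principal j h0 h1)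

theorem cls_v_succ {n : ℕ} (hn : n + 1 < g) :
    C.cls (MetricGraph.Point.vertex (C.v ⟨n + 1, hn⟩)) =
      C.cls (MetricGraph.Point.vertex (C.w ⟨n, by omega⟩)) := by
  by_cases hb : 0 < C.bridge ⟨n, by omega⟩
  · have := C.cls_bridge ⟨⟨n, by omega⟩, hb⟩ hb le_rfl
    have h2 := C.onEdge_edgeLength (Edge.link ⟨⟨n, by omega⟩, hb⟩)
    rw [edgeLength] at h2
    rw [h2] at this
    exact this
  · rw [C.v_succ_of_not_open hn hb]

/-- The class that has the given coordinates of a vertex. -/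
noncomputable def vertexSum (hg : 0 < g) (n : ℕ) : C.graph.Divisor ⧸ C.graph.principal :=
  C.cls (C.marked hg) +
    ∑ i : Fin g, if n ≤ i.val then C.shift i ((-C.a i : ℝ) : AddCircle (C.cycleLength i)) else 0

theorem vertexSum_eq_succ (hg : 0 < g) (i : Fin g) : C.vertexSum hg i.val =
    C.vertexSum hg (i.val + 1) + C.shift i ((-C.a i : ℝ) : AddCircle (C.cycleLength i)) := by
  have : ∀ k : Fin g,
      (if i.val ≤ k.val then C.shift k ((-C.a k : ℝ) : AddCircle (C.cycleLength k)) else 0) =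
      (if i.val + 1 ≤ k.val then C.shift k ((-C.a k : ℝ) : AddCircle (C.cycleLength k)) else 0) +
      (if i = k then C.shift k ((-C.a k : ℝ) : AddCircle (C.cycleLength k)) else 0) := by
    intro k
    rcases lt_trichotomy i k with h | h | h
    · have : i.val < k.val := h
      rw [if_pos this.le, if_pos (Nat.succ_le_of_lt this), if_neg h.ne, add_zero]
    · subst h
      simp
    · have : k.val < i.val := h
      rw [if_neg (by omega), if_neg (by omega), if_neg h.ne', add_zero]
  rw [vertexSum, Finset.sum_congr rfl (fun k _ => this k), Finset.sum_add_distrib,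
    Finset.sum_ite_eq, if_pos (Finset.mem_univ _), ← add_assoc]
  rfl

/-- Walking leftwards from the marked point, bridges preserve the class and each passage from `w i`
to `v i` adds `shift i (-a i)`. -/
theorem cls_v_w (hg : 0 < g) (i : Fin g) :
    C.cls (MetricGraph.Point.vertex (C.v i)) = C.vertexSum hg i.val ∧
      C.cls (MetricGraph.Point.vertex (C.w i)) = C.vertexSum hg (i.val + 1) := by
  suffices h : C.cls (MetricGraph.Point.vertex (C.w i)) = C.vertexSum hg (i.val + 1) by
    refine ⟨?_, h⟩
    rw [cls_v, vertexSum_eq_succ, h]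
  obtain ⟨m, hm⟩ : ∃ m, i.val + 1 + m = g := ⟨g - (i.val + 1), by omega⟩
  induction m generalizing i with
  | zero =>
    have hi : i = ⟨g - 1, by omega⟩ := Fin.ext (by simp only; omega)
    rw [vertexSum, Finset.sum_eq_zero, add_zero, hi]
    · rfl
    · intro k _
      rw [if_neg (by omega)]
  | succ m ih =>
    have h := ih ⟨i.val + 1, by omega⟩ (by simp only; omega)
    rw [← C.cls_v_succ (n := i.val) (by omega), cls_v, h]
    exact (C.vertexSum_eq_succ hg ⟨i.val + 1, by omega⟩).symm

theorem cls_vertex (hg : 0 < g) (x : C.Vertex) :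
    C.cls (MetricGraph.Point.vertex x) = C.vertexSum hg (C.index x) := by
  rcases x with i | _ | j
  · exact (C.cls_v_w hg i).2
  · have h : (Vertex.start : C.Vertex) = C.v ⟨0, hg⟩ := by simp [v]
    rw [h, index_v]
    exact (C.cls_v_w hg _).1
  · rw [← v_succ_of_open, index_v]
    exact (C.cls_v_w hg _).1

theorem cls_eq (hg : 0 < g) (p : C.graph.Point) : C.cls p = C.cls (C.marked hg) +
    ∑ i : Fin g, C.shift i ((C.coord i p : ℝ) : AddCircle (C.cycleLength i)) := by
  have hx : ∀ x : C.Vertex, C.cls (MetricGraph.Point.vertex x) = C.cls (C.marked hg) +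
      ∑ i : Fin g, C.shift i ((C.vertexCoord i x : ℝ) : AddCircle (C.cycleLength i)) := by
    intro x
    rw [cls_vertex C hg, vertexSum]
    congr 1
    refine Finset.sum_congr rfl fun i _ => ?_
    rw [vertexCoord]
    split_ifs <;> simp
  rcases p with x | ⟨e, t, h0, h1⟩
  · exact hx x
  · have e1 : ∀ i : Fin g, C.shift i ((C.coord i (MetricGraph.Point.interior e t h0 h1) : ℝ) :
        AddCircle (C.cycleLength i)) =
        C.shift i ((C.vertexCoord i (C.src e) : ℝ) : AddCircle (C.cycleLength i)) +
        C.speed i e • C.shift i (t : AddCircle (C.cycleLength i)) := by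
      intro i
      rw [coord, AddCircle.coe_add, map_add, ← zsmul_eq_mul, AddCircle.coe_zsmul, map_zsmul]
    rw [Finset.sum_congr rfl (fun i _ => e1 i), Finset.sum_add_distrib, ← add_assoc, ← hx]
    rcases e with k | k | j
    · rw [← C.cyc_of_vw k h0 h1, cls_cyc, AddCircle.coe_add, map_add, ← add_assoc, ← cls_v]
      congr 1
      simp [speed]
    · rw [← C.cyc_of_wv k h0 h1, cls_cyc]
      congr 1
      simp [speed]
    · rw [← MetricGraph.onEdge_interior (Γ := C.graph) (Edge.link j : C.Edge) h0 h1,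
        C.cls_bridge j h0 h1.le]
      simp [speed]

/-- The class is determined by degree and coordinates, which is the substantial half of the
Abel–Jacobi theorem. -/
theorem mk_eq (hg : 0 < g) (D : C.graph.Divisor) :
    (QuotientAddGroup.mk D : C.graph.Divisor ⧸ C.graph.principal) =
      C.graph.deg D • C.cls (C.marked hg) + ∑ i : Fin g, C.shift i (C.aj i D) := by
  induction D using Finsupp.induction_linear with
  | zero => simp
  | add D D' h h' =>
    rw [QuotientAddGroup.mk_add, h, h', map_add, add_zsmul]
    simp only [map_add, Finset.sum_add_distrib]
    abel
  | single p n =>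
    have : (QuotientAddGroup.mk (Finsupp.single p n) : C.graph.Divisor ⧸ C.graph.principal) =
        n • C.cls p := by
      rw [cls, ← QuotientAddGroup.mk_zsmul, Finsupp.smul_single, smul_eq_mul, mul_one]
    rw [this, C.cls_eq hg, MetricGraph.deg_single, zsmul_add, ← Finset.sum_zsmul]
    simp only [aj_single, map_zsmul]

/-- A divisor is principal if and only if its degree and all its coordinates vanish. -/
theorem mem_principal_iff (hg : 0 < g) (D : C.graph.Divisor) :
    D ∈ C.graph.principal ↔ C.graph.deg D = 0 ∧ ∀ i, C.aj i D = 0 := by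
  refine ⟨fun h => ⟨MetricGraph.deg_eq_zero_of_mem_principal h,
    fun i => C.aj_eq_zero_of_mem_principal i h⟩, fun ⟨h0, h⟩ => ?_⟩
  rw [← QuotientAddGroup.eq_zero_iff, C.mk_eq hg, h0, zero_zsmul, zero_add]
  exact Finset.sum_eq_zero fun i _ => by rw [h, map_zero]

end ChainOfCycles

/-! ## Iterated displacement -/

open Classical in
/-- Rows of the partition obtained from the empty one by successive displacements: at the `n`-th
step a box is added to each row `c` that ends on a diagonal where `P n` holds, provided that the
previous row is longer. The value at `c` is `c` minus the length of the row `c`. -/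
noncomputable def displacementRow (P : ℕ → ℤ → Prop) : ℕ → ℕ → ℤ
  | 0, c => c
  | n + 1, c =>
    if P n (displacementRow P n c) ∧
        (∀ c', c = c' + 1 → displacementRow P n c' + 1 < displacementRow P n c) then
      displacementRow P n c - 1
    else displacementRow P n c

section

variable {P : ℕ → ℤ → Prop}

theorem displacementRow_zero (c : ℕ) : displacementRow P 0 c = c := rfl

theorem displacementRow_succ_of {n c : ℕ} (h : P n (displacementRow P n c))
    (h' : ∀ c', c = c' + 1 → displacementRow P n c' + 1 < displacementRow P n c) :
    displacementRow P (n + 1) c = displacementRow P n c - 1 := by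
  rw [displacementRow, if_pos ⟨h, h'⟩]

theorem displacementRow_succ_cases (n c : ℕ) :
    (displacementRow P (n + 1) c = displacementRow P n c - 1 ∧ P n (displacementRow P n c) ∧
      ∀ c', c = c' + 1 → displacementRow P n c' + 1 < displacementRow P n c) ∨
    (displacementRow P (n + 1) c = displacementRow P n c ∧ (¬ P n (displacementRow P n c) ∨
      ∃ c', c = c' + 1 ∧ displacementRow P n c ≤ displacementRow P n c' + 1)) := by
  rw [displacementRow]
  split_ifs with h
  · exact Or.inl ⟨rfl, h⟩
  · refine Or.inr ⟨rfl, ?_⟩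
    by_cases hP : P n (displacementRow P n c)
    · right
      by_contra! hc
      exact h ⟨hP, hc⟩
    · exact Or.inl hP

theorem displacementRow_succ_le (n c : ℕ) :
    displacementRow P (n + 1) c ≤ displacementRow P n c := by
  rcases displacementRow_succ_cases (P := P) n c with h | h <;> omega

theorem le_displacementRow_succ (n c : ℕ) :
    displacementRow P n c - 1 ≤ displacementRow P (n + 1) c := by
  rcases displacementRow_succ_cases (P := P) n c with h | h <;> omega

theorem displacementRow_antitone (c : ℕ) : Antitone fun n => displacementRow P n c :=
  antitone_nat_of_succ_le fun n => displacementRow_succ_le n c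

theorem displacementRow_le (n c : ℕ) : displacementRow P n c ≤ c :=
  displacementRow_antitone c (Nat.zero_le n)

/-- A row grows only if the previous row was already longer before the step; growth of both in the
same step is no excuse. Hence the mixed times `n` and `n + 1`. -/
theorem displacementRow_lt_of_strict {n : ℕ}
    (h : ∀ c, displacementRow P n c + 1 ≤ displacementRow P n (c + 1)) (c : ℕ) :
    displacementRow P n c + 1 ≤ displacementRow P (n + 1) (c + 1) := by
  rcases displacementRow_succ_cases (P := P) n (c + 1) with ⟨h1, -, h2⟩ | ⟨h1, -⟩
  · have := h2 c rfl
    omega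
  · rw [h1]
    exact h c

theorem displacementRow_strict (n c : ℕ) :
    displacementRow P n c + 1 ≤ displacementRow P n (c + 1) := by
  induction n generalizing c with
  | zero => simp [displacementRow_zero]
  | succ n ih =>
    have := displacementRow_lt_of_strict ih c
    have := displacementRow_succ_le (P := P) n c
    omega

theorem displacementRow_add_le (n c k : ℕ) :
    displacementRow P n c + k ≤ displacementRow P n (c + k) := by
  induction k with
  | zero => simp
  | succ k ih =>
    have := displacementRow_strict (P := P) n (c + k)
    rw [← add_assoc]
    push_cast
    omega

/-- Bounds what a subtracted divisor gains by putting `k + 1` chips on one cycle. -/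
theorem displacementRow_add_le_succ (n c k : ℕ) :
    displacementRow P n c + (k + 1) ≤ displacementRow P (n + 1) (c + (k + 1)) := by
  have h1 : _ ≤ displacementRow P (n + 1) (c + (k + 1)) :=
    displacementRow_lt_of_strict (P := P) (displacementRow_strict n) (c + k)
  have h2 := displacementRow_add_le (P := P) n c k
  omega

end

namespace ChainOfCycles

variable {g : ℕ} (C : ChainOfCycles g)

/-! ## Effective divisor classes -/

theorem aj_single_cyc (i k : Fin g) (u : ℝ) (n : ℤ) :
    C.aj i (Finsupp.single (C.cyc k u) n) =
      n • (if k = i then (u : AddCircle (C.cycleLength i))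
        else if k < i then ((-C.a i : ℝ) : AddCircle (C.cycleLength i)) else 0) := by
  rw [aj_single, coe_coord_cyc]

theorem aj_marked (hg : 0 < g) (i : Fin g) (n : ℤ) :
    C.aj i (Finsupp.single (C.marked hg) n) = 0 := by
  have : C.marked hg = C.cyc ⟨g - 1, by omega⟩ 0 := (C.cyc_zero _).symm
  have hlt : ¬ (⟨g - 1, by omega⟩ : Fin g) < i := by
    rw [Fin.lt_def]; simp only; omega
  rw [this, aj_single_cyc, if_neg hlt]
  simp

/-- A numerical certificate that a divisor is equivalent to an effective one: `N n` is the number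
of chips on the first `n` cycles. -/
def IsWalk (D : C.graph.Divisor) (N : ℕ → ℤ) : Prop :=
  N 0 = 0 ∧ ∀ i : Fin g, N i.val ≤ N (i.val + 1) ∧
    (N (i.val + 1) = N i.val →
      C.aj i D + N i.val • (C.a i : AddCircle (C.cycleLength i)) = 0)

/-- The effective divisor is built cycle by cycle. One chip per rise of the walk suffices to correct
the coordinate. -/
theorem isEquivEffective_of_isWalk (hg : 0 < g) {D : C.graph.Divisor} {N : ℕ → ℤ}
    (hN : C.IsWalk D N) (hd : N g ≤ C.graph.deg D) : C.graph.IsEquivEffective D := by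
  obtain ⟨hN0, hN⟩ := hN
  have key : ∀ n ≤ g, ∃ D' : C.graph.Divisor, 0 ≤ D' ∧ C.graph.deg D' = N n ∧
      ∀ i : Fin g, C.aj i D' = if i.val < n then C.aj i D
        else -(N n • (C.a i : AddCircle (C.cycleLength i))) := by
    intro n
    induction n with
    | zero =>
      intro _
      exact ⟨0, le_rfl, by rw [map_zero, hN0], fun i => by simp [hN0]⟩
    | succ n ih =>
      intro hn
      obtain ⟨D', h0, hdeg, haj⟩ := ih (by omega)
      obtain ⟨hle, heq⟩ := hN ⟨n, hn⟩
      simp only at hle heq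
      rcases hle.eq_or_lt with h | h
      · refine ⟨D', h0, by rw [hdeg, h], fun i => ?_⟩
        rw [haj, ← h]
        rcases lt_trichotomy i.val n with hi | hi | hi
        · rw [if_pos hi, if_pos (by omega)]
        · obtain rfl : i = ⟨n, hn⟩ := Fin.ext hi
          rw [if_neg (by simp), if_pos (by simp)]
          exact (eq_neg_of_add_eq_zero_left (heq h.symm)).symm
        · rw [if_neg (by omega), if_neg (by omega)]
      -- The position `θ` compensates for the `N n` chips on the left, which contribute `-a` each.
      -- The remaining new chips go to `w`, where the coordinate is zero.
      · obtain ⟨θ, hθ⟩ : ∃ θ : ℝ, (θ : AddCircle (C.cycleLength ⟨n, hn⟩)) = C.aj ⟨n, hn⟩ D +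
            N n • (C.a ⟨n, hn⟩ : AddCircle (C.cycleLength ⟨n, hn⟩)) :=
          QuotientAddGroup.mk_surjective _
        refine ⟨D' + Finsupp.single (C.cyc ⟨n, hn⟩ 0) (N (n + 1) - N n - 1) +
          Finsupp.single (C.cyc ⟨n, hn⟩ θ) 1, ?_, ?_, fun i => ?_⟩
        · refine add_nonneg (add_nonneg h0 ?_) ?_
          · exact Finsupp.single_nonneg.2 (by omega)
          · exact Finsupp.single_nonneg.2 (by omega)
        · rw [map_add, map_add, hdeg, MetricGraph.deg_single, MetricGraph.deg_single]
          ring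
        · rw [map_add, map_add, haj, aj_single_cyc, aj_single_cyc]
          rcases lt_trichotomy i.val n with hi | hi | hi
          · have h1 : (⟨n, hn⟩ : Fin g) ≠ i := fun h => by rw [← h] at hi; simp at hi
            have h2 : ¬ (⟨n, hn⟩ : Fin g) < i := by rw [Fin.lt_def]; simp only; omega
            simp [hi, h1, h2, Nat.lt_succ_of_lt hi]
          · obtain rfl : i = ⟨n, hn⟩ := Fin.ext hi
            simp [hθ]
          · have h1 : (⟨n, hn⟩ : Fin g) ≠ i := fun h => by rw [← h] at hi; simp at hi
            have h2 : (⟨n, hn⟩ : Fin g) < i := hi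
            rw [if_neg (by omega), if_neg h1, if_pos h2, if_neg h1, if_neg (by omega),
              AddCircle.coe_neg]
            module
  obtain ⟨D', h0, hdeg, haj⟩ := key g le_rfl
  refine ⟨D' + Finsupp.single (C.marked hg) (C.graph.deg D - N g),
    add_nonneg h0 (Finsupp.single_nonneg.2 (by omega)), ?_⟩
  rw [C.mem_principal_iff hg]
  refine ⟨?_, fun i => ?_⟩
  · rw [map_sub, map_add, hdeg, MetricGraph.deg_single]
    ring
  · rw [map_sub, map_add, haj, if_pos i.isLt, aj_marked]
    simp

/-- The cycle to which a point is attributed. -/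
def cell : C.graph.Point → ℕ
  | MetricGraph.Point.vertex x => C.index x - 1
  | MetricGraph.Point.interior e _ _ _ =>
    match (e : C.Edge) with
    | Edge.vw k => k.val
    | Edge.wv k => k.val
    | Edge.link j => j.val.val

theorem cell_lt (hg : 0 < g) (p : C.graph.Point) : C.cell p < g := by
  rcases p with (k | _ | j) | ⟨(k | k | j), t, h0, h1⟩ <;> simp only [cell, index] <;> omega

/-- Bridges and their right ends are attributed to the cycle on their left, and `start` to the first
cycle, so a point of an earlier cell always contracts to `v i`. -/
theorem coord_of_cell_lt (i : Fin g) {p : C.graph.Point} (h : C.cell p < i.val) :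
    C.coord i p = -C.a i := by
  rcases p with x | ⟨(k | k | j), t, h0, h1⟩
  · simp only [cell] at h
    simp only [coord, vertexCoord]
    rw [if_pos (by omega)]
  · have h : k < i := h
    simp [coord, src, vertexCoord_v, speed, h.le, h.ne]
  · have h : k < i := h
    simp [coord, src, vertexCoord_w, speed, h, h.ne]
  · have h : j.val.val < i.val := h
    simp [coord, src, vertexCoord_w, speed, Fin.lt_def, h]

theorem coord_of_lt_cell (i : Fin g) {p : C.graph.Point} (h : i.val < C.cell p) :
    C.coord i p = 0 := by
  rcases p with x | ⟨(k | k | j), t, h0, h1⟩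
  · simp only [cell] at h
    simp only [coord, vertexCoord]
    rw [if_neg (by omega)]
  · have h : i < k := h
    simp [coord, src, vertexCoord_v, speed, h, h.ne']
  · have h : i < k := h
    simp [coord, src, vertexCoord_w, speed, h.le, h.ne']
  · have h : i.val < j.val.val := h
    simp [coord, src, vertexCoord_w, speed, Fin.lt_def, h.le]

/-- `N n` counts the chips in the first `n` cells. If cell `i` is empty, the chips to its left
contribute `-a i` each and the others nothing. -/
theorem exists_isWalk_of_nonneg (hg : 0 < g) {E : C.graph.Divisor} (hE : 0 ≤ E) :
    ∃ N, C.IsWalk E N ∧ N g = C.graph.deg E := by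
  classical
  refine ⟨fun n => ∑ p ∈ E.support, if C.cell p < n then E p else 0, ⟨by simp, fun i => ⟨?_, ?_⟩⟩,
    ?_⟩
  · refine Finset.sum_le_sum fun p _ => ?_
    have := hE p
    rw [Finsupp.zero_apply] at this
    split_ifs <;> omega
  · intro h
    have h1 : ∀ p ∈ E.support, (if C.cell p < i.val then E p else 0) =
        if C.cell p < i.val + 1 then E p else 0 := by
      refine (Finset.sum_eq_sum_iff_of_le fun p _ => ?_).1 h.symm
      have := hE p
      rw [Finsupp.zero_apply] at this
      split_ifs <;> omega
    rw [aj_apply, Finsupp.sum, Finset.sum_smul, ← Finset.sum_add_distrib]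
    refine Finset.sum_eq_zero fun p hp => ?_
    have h2 := h1 p hp
    rcases lt_trichotomy (C.cell p) i.val with hc | hc | hc
    · rw [if_pos hc, C.coord_of_cell_lt i hc, AddCircle.coe_neg]
      simp
    · rw [if_neg (by omega), if_pos (by omega)] at h2
      rw [← h2]
      simp
    · rw [if_neg (by omega), C.coord_of_lt_cell i hc]
      simp
  · change _ = ∑ p ∈ E.support, E p
    exact Finset.sum_congr rfl fun p _ => if_pos (C.cell_lt hg p)

/-! ## The rank of a divisor at the marked point -/

/-- The condition under which the chips on the cycles up to the `i`-th one can be moved on without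
loss. -/
def Resonates (D : C.graph.Divisor) (i : ℕ) (n : ℤ) : Prop :=
  ∃ h : i < g, C.aj ⟨i, h⟩ D +
    ((i : ℤ) + n) • (C.a ⟨i, h⟩ : AddCircle (C.cycleLength ⟨i, h⟩)) = 0

theorem coe_a_ne_zero (i : Fin g) : (C.a i : AddCircle (C.cycleLength i)) ≠ 0 := by
  intro h
  obtain ⟨n, hn⟩ := (AddCircle.coe_eq_zero_iff _).1 h
  rw [zsmul_eq_mul] at hn
  have ha := C.a_pos i
  have hb := C.b_pos i
  have hl := C.cycleLength_pos i
  have h0 : (0 : ℝ) < n := by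
    by_contra hneg
    have := mul_nonpos_of_nonpos_of_nonneg (not_lt.1 hneg) hl.le
    linarith
  have h1 : (1 : ℝ) ≤ n := by exact_mod_cast h0
  have := mul_le_mul_of_nonneg_right h1 hl.le
  rw [cycleLength] at *
  linarith

/-- An effective divisor that is hardest to subtract. -/
theorem exists_worst_divisor (D : C.graph.Divisor) {n : ℕ} (hn : n ≤ g) (c : ℕ) :
    ∃ E : C.graph.Divisor, 0 ≤ E ∧ C.graph.deg E = c ∧
      (∀ i : Fin g, n ≤ i.val →
        C.aj i E = -((c : ℤ) • (C.a i : AddCircle (C.cycleLength i)))) ∧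
      ∀ N : ℕ → ℤ, N 0 = 0 → (∀ i : Fin g, i.val < n → N i.val ≤ N (i.val + 1) ∧
        (N (i.val + 1) = N i.val →
          C.aj i (D - E) + N i.val • (C.a i : AddCircle (C.cycleLength i)) = 0)) →
        displacementRow (C.Resonates D) n c + n - c ≤ N n := by
  induction n generalizing c with
  | zero =>
    -- All chips sit at the leftmost vertex, which has coordinate `-a i` on every cycle.
    refine ⟨Finsupp.single (MetricGraph.Point.vertex Vertex.start) (c : ℤ),
      Finsupp.single_nonneg.2 (by omega), MetricGraph.deg_single _ _, fun i _ => ?_,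
      fun N hN _ => ?_⟩
    · rw [aj_single]
      simp [coord, vertexCoord, index]
    · rw [hN, displacementRow_zero]
      simp
  | succ n ih =>
    rcases displacementRow_succ_cases (P := C.Resonates D) n c with
      ⟨h1, -, -⟩ | ⟨h1, h2 | ⟨c', rfl, h2⟩⟩
    -- Row `c` gains a box: the bound does not rise, and no new chip is needed.
    · obtain ⟨E, hE0, hEd, hEa, hE⟩ := ih (by omega) c
      refine ⟨E, hE0, hEd, fun i hi => hEa i (by omega), fun N hN0 hN => ?_⟩
      have h3 := hE N hN0 fun i hi => hN i (by omega)
      have h4 := (hN ⟨n, by omega⟩ (by simp)).1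
      simp only at h4
      rw [h1]
      push_cast
      omega
    -- No resonance: a walk at its minimum must rise without any chip of `E` on cycle `n`.
    · obtain ⟨E, hE0, hEd, hEa, hE⟩ := ih (by omega) c
      refine ⟨E, hE0, hEd, fun i hi => hEa i (by omega), fun N hN0 hN => ?_⟩
      have h3 := hE N hN0 fun i hi => hN i (by omega)
      obtain ⟨h4, h5⟩ := hN ⟨n, by omega⟩ (by simp)
      simp only at h4 h5
      rw [h1]
      push_cast
      by_contra hlt
      have h6 : N n = displacementRow (C.Resonates D) n c + n - c := by omega
      have h7 := h5 (by omega)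
      refine h2 ⟨by omega, ?_⟩
      rw [← h7, map_sub, hEa _ (by simp), h6]
      module
    -- Row `c' + 1` is blocked by row `c'`: the worst choice saves the last chip for cycle `n`.
    · obtain ⟨E, hE0, hEd, hEa, hE⟩ := ih (by omega) c'
      let k : Fin g := ⟨n, by omega⟩
      -- The `- 1` makes the quantity that must vanish for a minimal walk to stay constant equal to
      -- `a k`, which is not zero on the circle.
      obtain ⟨θ, hθ⟩ : ∃ θ : ℝ, (θ : AddCircle (C.cycleLength k)) = C.aj k D +
          ((n : ℤ) + displacementRow (C.Resonates D) n c' - 1) • (C.a k : AddCircle (C.cycleLength k)) :=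
        QuotientAddGroup.mk_surjective _
      refine ⟨E + Finsupp.single (C.cyc k θ) 1, add_nonneg hE0 (Finsupp.single_nonneg.2 (by omega)),
        by rw [map_add, hEd, MetricGraph.deg_single]; push_cast; ring, fun i hi => ?_,
        fun N hN0 hN => ?_⟩
      · have h3 : k ≠ i := fun h => by rw [← h] at hi; simp [k] at hi
        have h4 : k < i := hi
        rw [map_add, hEa i (by omega), aj_single_cyc, if_neg h3, if_pos h4, AddCircle.coe_neg]
        push_cast
        module
      · have h3 := hE N hN0 fun i hi => by
          have h4 : k ≠ i := fun h => by rw [← h] at hi; simp [k] at hi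
          have h5 : ¬ k < i := by
            have : i.val < k.val := hi
            rw [Fin.lt_def]; omega
          have := hN i (by omega)
          rwa [← sub_sub, map_sub _ (D - E), aj_single_cyc, if_neg h4, if_neg h5, smul_zero,
            sub_zero] at this
        obtain ⟨h4, h5⟩ := hN k (by simp [k])
        simp only [k] at h4 h5
        rw [h1]
        push_cast
        by_contra hlt
        have h6 : N n = displacementRow (C.Resonates D) n c' + n - c' := by omega
        have h7 := h5 (by omega)
        refine C.coe_a_ne_zero k ?_
        rw [← h7, ← sub_sub, map_sub, map_sub, hEa k le_rfl, aj_single_cyc, if_pos rfl, hθ, h6]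
        module

/-- The rank at the marked point of a divisor class of degree zero is governed by the displacement
process. -/
theorem rankGE_iff (hg : 0 < g) {D : C.graph.Divisor} (hD : C.graph.deg D = 0) (d : ℤ) (r : ℕ) :
    C.graph.RankGE (D + d • Finsupp.single (C.marked hg) 1) r ↔
      displacementRow (C.Resonates D) g r ≤ d - g := by
  classical
  have hdeg : ∀ E : C.graph.Divisor,
      C.graph.deg (D + d • Finsupp.single (C.marked hg) 1 - E) = d - C.graph.deg E := by
    intro E
    rw [map_sub, map_add, hD, map_zsmul, MetricGraph.deg_single]
    simp
  have haj : ∀ (E : C.graph.Divisor) (i : Fin g),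
      C.aj i (D + d • Finsupp.single (C.marked hg) 1 - E) = C.aj i (D - E) := by
    intro E i
    rw [map_sub, map_add, map_zsmul, aj_marked, smul_zero, add_zero, map_sub]
  constructor
  · intro h
    obtain ⟨E, hE0, hEd, -, hE⟩ := C.exists_worst_divisor D le_rfl r
    obtain ⟨D', hD0, hD'⟩ := h E hE0 hEd
    rw [C.mem_principal_iff hg] at hD'
    obtain ⟨N, ⟨hN0, hN⟩, hNg⟩ := C.exists_isWalk_of_nonneg hg hD0
    have h1 : C.graph.deg D' = d - r := by
      have := hD'.1
      rw [map_sub, hdeg, hEd] at this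
      omega
    have h2 : ∀ i, C.aj i D' = C.aj i (D - E) := by
      intro i
      have := hD'.2 i
      rw [map_sub, haj, sub_eq_zero] at this
      exact this.symm
    have := hE N hN0 fun i _ => by
      rw [← h2]
      exact hN i
    omega
  · intro h E hE0 hEd
    obtain ⟨c, ⟨hc0, hc⟩, hcg⟩ := C.exists_isWalk_of_nonneg hg hE0
    -- The greedy walk: it stays whenever the coordinate allows it, and otherwise rises by one.
    let step : ℕ → ℤ → ℤ := fun n x =>
      if ∃ h : n < g, C.aj ⟨n, h⟩ (D - E) +
        x • (C.a ⟨n, h⟩ : AddCircle (C.cycleLength ⟨n, h⟩)) = 0 then x else x + 1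
    let N : ℕ → ℤ := fun n => Nat.rec (motive := fun _ => ℤ) 0 step n
    have hNs : ∀ n, N (n + 1) = step n (N n) := fun n => rfl
    have key : ∀ n ≤ g, ∃ c' : ℕ, c n = c' ∧
        N n ≤ displacementRow (C.Resonates D) n c' + n - c' := by
      intro n
      induction n with
      | zero =>
        intro _
        exact ⟨0, by simpa using hc0, by simp [displacementRow_zero, N]⟩
      | succ n ih =>
        intro hn
        obtain ⟨c', hc', hle⟩ := ih (by omega)
        obtain ⟨h1, h2⟩ := hc ⟨n, by omega⟩
        simp only at h1 h2
        have hstep : N (n + 1) ≤ N n + 1 := by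
          rw [hNs]
          simp only [step]
          split_ifs <;> omega
        rcases h1.eq_or_lt with h1 | h1
        · refine ⟨c', by rw [← h1, hc'], ?_⟩
          have h3 := le_displacementRow_succ (P := C.Resonates D) n c'
          by_cases hlt : N (n + 1) ≤ N n
          · push_cast
            omega
          · rcases displacementRow_succ_cases (P := C.Resonates D) n c' with h4 | h4
            -- The bound can fail only if the row gains a box while the walk rises from its bound,
            -- but the resonance that adds the box lets the walk stay.
            · by_cases h5 : N n = displacementRow (C.Resonates D) n c' + n - c'
              · refine absurd ?_ hlt
                rw [hNs]
                simp only [step]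
                rw [if_pos]
                obtain ⟨h6, h7⟩ := h4.2.1
                refine ⟨h6, ?_⟩
                have h8 := eq_neg_of_add_eq_zero_left (h2 h1.symm)
                rw [hc'] at h8
                rw [← h7, map_sub, h8, h5]
                module
              · push_cast
                omega
            · push_cast
              omega
        · obtain ⟨k, hk⟩ : ∃ k : ℕ, c (n + 1) = c n + (k + 1) :=
            ⟨(c (n + 1) - c n - 1).toNat, by omega⟩
          refine ⟨c' + (k + 1), by rw [hk, hc']; push_cast; ring, ?_⟩
          have h3 := displacementRow_add_le_succ (P := C.Resonates D) n c' k
          push_cast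
          omega
    refine C.isEquivEffective_of_isWalk hg (N := N) ⟨rfl, fun i => ?_⟩ ?_
    · rw [hNs]
      simp only [step]
      split_ifs with h'
      · refine ⟨le_rfl, fun _ => ?_⟩
        rw [haj]
        exact h'.choose_spec
      · exact ⟨by omega, fun h'' => by omega⟩
    · obtain ⟨c', hc', hle⟩ := key g le_rfl
      have : c' = r := by
        have : (c' : ℤ) = r := by rw [← hc', hcg, hEd]
        exact_mod_cast this
      subst this
      rw [hdeg, hEd]
      omega

end ChainOfCycles

/-- The boxes of a partition are all added by the displacement process within `g` steps if and only
if the partition carries a tableau recording admissible steps. -/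
theorem displacementRow_le_iff_exists_tableau {g : ℕ} (P : ℕ → ℤ → Prop) (lam : YoungDiagram) :
    (∀ p ∈ lam, displacementRow P g p.1 ≤ (p.1 : ℤ) - p.2 - 1) ↔
      ∃ t : {c : ℕ × ℕ // c ∈ lam} → Fin g,
        (∀ c c', boxY c.val = boxY c'.val → boxX c.val < boxX c'.val → t c < t c') ∧
        (∀ c c', boxX c.val = boxX c'.val → boxY c.val < boxY c'.val → t c < t c') ∧
        ∀ p, P (t p).val (boxY p.val - boxX p.val) := by
  classical
  constructor
  · intro h
    have hex : ∀ p : {c : ℕ × ℕ // c ∈ lam},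
        ∃ n, displacementRow P n p.val.1 ≤ (p.val.1 : ℤ) - p.val.2 - 1 :=
      fun p => ⟨g, h p.val p.property⟩
    -- The label of a box is the step that adds it. Rows grow by at most one box per step, so this
    -- step is well defined.
    have hstep : ∀ p : {c : ℕ × ℕ // c ∈ lam}, ∃ n, n < g ∧
        displacementRow P n p.val.1 = (p.val.1 : ℤ) - p.val.2 ∧
        displacementRow P (n + 1) p.val.1 = (p.val.1 : ℤ) - p.val.2 - 1 := by
      intro p
      obtain ⟨n, hn⟩ : ∃ n, Nat.find (hex p) = n + 1 := by
        refine Nat.exists_eq_succ_of_ne_zero fun h0 => ?_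
        have := Nat.find_spec (hex p)
        rw [h0, displacementRow_zero] at this
        omega
      have h1 := Nat.find_spec (hex p)
      have h2 := Nat.find_min (hex p) (m := n) (by omega)
      have h3 := Nat.find_min' (hex p) (h p.val p.property)
      have h4 := le_displacementRow_succ (P := P) n p.val.1
      rw [hn] at h1 h3
      exact ⟨n, by omega, by omega, by omega⟩
    choose t ht ht0 ht1 using hstep
    refine ⟨fun p => ⟨t p, ht p⟩, fun p p' hy hx => ?_, fun p p' hx hy => ?_, fun p => ?_⟩
    · simp only [boxX, boxY] at hx hy
      change t p < t p'
      have hrow : p.val.1 = p'.val.1 := by omega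
      by_contra hlt
      have h1 := displacementRow_antitone (P := P) p.val.1 (not_lt.1 hlt)
      have h2 := ht0 p
      have h3 := ht0 p'
      simp only at h1
      rw [← hrow] at h3
      omega
    · simp only [boxX, boxY] at hx hy
      change t p < t p'
      by_contra hlt
      have h1 := displacementRow_antitone (P := P) p.val.1 (not_lt.1 hlt)
      obtain ⟨k, hk⟩ : ∃ k, p'.val.1 = p.val.1 + k + 1 := ⟨p'.val.1 - p.val.1 - 1, by omega⟩
      -- When the lower box is added, the row just above it is already longer, and so are all
      -- earlier rows; hence the upper box is present.
      have h2 : displacementRow P (t p') (p.val.1 + k) + 1 < displacementRow P (t p') p'.val.1 := by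
        rcases displacementRow_succ_cases (P := P) (t p') p'.val.1 with ⟨-, -, h3⟩ | ⟨h3, -⟩
        · exact h3 _ hk
        · have := ht0 p'
          have := ht1 p'
          omega
      have h3 := displacementRow_add_le (P := P) (t p') p.val.1 k
      have h4 := ht0 p
      have h5 := ht0 p'
      simp only at h1
      omega
    · have h1 := ht0 p
      have h2 := ht1 p
      rcases displacementRow_succ_cases (P := P) (t p) p.val.1 with ⟨-, h3, -⟩ | ⟨h3, -⟩
      · rw [h1] at h3
        convert h3 using 1
        simp only [boxX, boxY]
        ring
      · omega
  · rintro ⟨t, hrow, hcol, hP⟩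
    -- By time `n` all boxes with label below `n` are present: the left and upper neighbours have
    -- smaller labels, so there is room for a box when its label comes up.
    have key : ∀ n ≤ g, ∀ p : {c : ℕ × ℕ // c ∈ lam}, (t p).val < n →
        displacementRow P n p.val.1 ≤ (p.val.1 : ℤ) - p.val.2 - 1 := by
      intro n
      induction n with
      | zero => intro _ p hp; omega
      | succ n ih =>
        rintro hn ⟨⟨r, c⟩, hp⟩ hlt
        simp only
        rcases Nat.lt_succ_iff_lt_or_eq.1 hlt with hlt | heq
        · exact (displacementRow_succ_le n r).trans (ih (by omega) ⟨(r, c), hp⟩ hlt)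
        · have hleft : displacementRow P n r ≤ (r : ℤ) - c := by
            cases c with
            | zero => simpa using displacementRow_le n r
            | succ c =>
              have hm : (r, c) ∈ lam := lam.up_left_mem le_rfl (Nat.le_succ c) hp
              have h1 := hrow ⟨(r, c), hm⟩ ⟨(r, c + 1), hp⟩ rfl (by simp [boxX])
              have h2 := ih (by omega) ⟨(r, c), hm⟩ (by
                rw [← heq]
                exact h1)
              simp only at h2
              push_cast
              omega
          rcases hleft.lt_or_eq with hlt' | heq'
          · have := displacementRow_succ_le (P := P) n r
            omega
          · rw [displacementRow_succ_of, heq']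
            · rw [heq', ← heq]
              convert hP ⟨(r, c), hp⟩ using 1
              simp only [boxX, boxY]
              ring
            · rintro r' rfl
              have hm : (r', c) ∈ lam := lam.up_left_mem (Nat.le_succ r') le_rfl hp
              have h1 := hcol ⟨(r', c), hm⟩ ⟨(r' + 1, c), hp⟩ rfl (by simp [boxY])
              have h2 := ih (by omega) ⟨(r', c), hm⟩ (by
                rw [← heq]
                exact h1)
              simp only at h2
              push_cast at heq'
              omega
    intro p hp
    exact key g le_rfl ⟨p, hp⟩ (t ⟨p, hp⟩).isLt

/-! ### Genus, torsion and tori in coordinates -/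

namespace ChainOfCycles

variable {g : ℕ} (C : ChainOfCycles g)

theorem genus_graph : C.graph.genus = g := by
  have hE : Nat.card C.Edge = g + g + Nat.card C.OpenBridge := by
    let f : C.Edge ≃ (Fin g ⊕ Fin g) ⊕ C.OpenBridge :=
      { toFun := fun e => match e with
          | Edge.vw i => Sum.inl (Sum.inl i)
          | Edge.wv i => Sum.inl (Sum.inr i)
          | Edge.link j => Sum.inr j
        invFun := fun e => match e with
          | Sum.inl (Sum.inl i) => Edge.vw i
          | Sum.inl (Sum.inr i) => Edge.wv i
          | Sum.inr j => Edge.link j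
        left_inv := by rintro (i | i | j) <;> rfl
        right_inv := by rintro ((i | i) | j) <;> rfl }
    rw [Nat.card_congr f, Nat.card_sum, Nat.card_sum, Nat.card_fin]
  have hV : Nat.card C.Vertex = g + (Nat.card C.OpenBridge + 1) := by
    let f : C.Vertex ≃ Fin g ⊕ Option C.OpenBridge :=
      { toFun := fun x => match x with
          | Vertex.right i => Sum.inl i
          | Vertex.start => Sum.inr none
          | Vertex.left j => Sum.inr (some j)
        invFun := fun x => match x with
          | Sum.inl i => Vertex.right i
          | Sum.inr none => Vertex.start
          | Sum.inr (some j) => Vertex.left j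
        left_inv := by rintro (i | _ | j) <;> rfl
        right_inv := by rintro (i | _ | j) <;> rfl }
    rw [Nat.card_congr f, Nat.card_sum, Finite.card_option, Nat.card_fin]
  have hE' : Fintype.card C.graph.Edge = g + g + Nat.card C.OpenBridge := by
    rw [← Nat.card_eq_fintype_card]
    exact hE
  have hV' : Fintype.card C.graph.Vertex = g + (Nat.card C.OpenBridge + 1) := by
    rw [← Nat.card_eq_fintype_card]
    exact hV
  rw [MetricGraph.genus, hE', hV']
  push_cast
  ring

/-- Both sides are zero by convention when no positive multiple of `a i` vanishes on the circle. -/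
theorem torsionOrder_eq_addOrderOf (i : Fin g) :
    C.torsionOrder i = addOrderOf (C.a i : AddCircle (C.cycleLength i)) := by
  have hiff : ∀ m : ℕ, (∃ k : ℤ, (m : ℝ) * C.a i = (k : ℝ) * C.cycleLength i) ↔
      m • (C.a i : AddCircle (C.cycleLength i)) = 0 := by
    intro m
    rw [← AddCircle.coe_nsmul, AddCircle.coe_eq_zero_iff]
    simp only [zsmul_eq_mul, nsmul_eq_mul, eq_comm]
  rw [torsionOrder]
  simp only [hiff]
  rcases Nat.eq_zero_or_pos (addOrderOf (C.a i : AddCircle (C.cycleLength i))) with h | h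
  · rw [h, Nat.sInf_eq_zero]
    right
    rw [Set.eq_empty_iff_forall_notMem]
    rintro m ⟨hm, hm'⟩
    exact absurd (addOrderOf_eq_zero_iff'.1 h m hm) (not_not.2 hm')
  · refine le_antisymm (Nat.sInf_le ⟨h, addOrderOf_nsmul_eq_zero _⟩) ?_
    have hne : {m : ℕ | 0 < m ∧ m • (C.a i : AddCircle (C.cycleLength i)) = 0}.Nonempty :=
      ⟨_, h, addOrderOf_nsmul_eq_zero _⟩
    obtain ⟨h1, h2⟩ := Nat.sInf_mem hne
    exact addOrderOf_le_of_nsmul_eq_zero h1 h2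

theorem torsionOrder_dvd_iff (i : Fin g) (n : ℤ) : (C.torsionOrder i : ℤ) ∣ n ↔
    n • (C.a i : AddCircle (C.cycleLength i)) = 0 := by
  rw [torsionOrder_eq_addOrderOf, addOrderOf_dvd_iff_zsmul_eq_zero]

/-- Congruent positions give the same point of the cycle. -/
theorem coe_mul_a_of_modEq (i : Fin g) {ξ : ℝ} {n : ℤ}
    (h : ξ ≡ (n : ℝ) [PMOD (C.torsionOrder i : ℝ)]) :
    ((ξ * C.a i : ℝ) : AddCircle (C.cycleLength i)) =
      n • (C.a i : AddCircle (C.cycleLength i)) := by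
  obtain ⟨z, hz⟩ := AddCommGroup.modEq_iff_zsmul.1 h
  have h1 := (C.torsionOrder_dvd_iff i (z * C.torsionOrder i)).1 (dvd_mul_left _ _)
  have h2 : ξ * C.a i = n • C.a i - (z * C.torsionOrder i : ℤ) • C.a i := by
    rw [zsmul_eq_mul, zsmul_eq_mul, ← sub_mul]
    congr 1
    rw [zsmul_eq_mul] at hz
    push_cast
    linarith
  rw [h2, AddCircle.coe_sub, AddCircle.coe_zsmul, AddCircle.coe_zsmul, h1, sub_zero]

/-- The divisor with one chip on each cycle, normalised to degree zero at the marked point. -/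
noncomputable def torusDivisor (hg : 0 < g) (ξ : Fin g → ℝ) : C.graph.Divisor :=
  (∑ i, Finsupp.single (C.cyclePoint i (ξ i)) 1) - (g : ℤ) • Finsupp.single (C.marked hg) 1

theorem deg_torusDivisor (hg : 0 < g) (ξ : Fin g → ℝ) : C.graph.deg (C.torusDivisor hg ξ) = 0 := by
  rw [torusDivisor, map_sub, map_sum, map_zsmul, MetricGraph.deg_single]
  simp [MetricGraph.deg_single]

/-- The `i` chips on earlier cycles contribute `-a i` each; later chips and the marked point
contribute nothing. -/
theorem aj_torusDivisor (hg : 0 < g) (ξ : Fin g → ℝ) (i : Fin g) :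
    C.aj i (C.torusDivisor hg ξ) = ((ξ i * C.a i : ℝ) : AddCircle (C.cycleLength i)) -
      (i.val : ℤ) • (C.a i : AddCircle (C.cycleLength i)) := by
  rw [torusDivisor, map_sub, map_zsmul, aj_marked, smul_zero, sub_zero, map_sum]
  simp only [cyclePoint_eq_cyc, aj_single_cyc, one_smul]
  have h : ∀ k : Fin g, (if k = i then ((ξ k * C.a k : ℝ) : AddCircle (C.cycleLength i))
        else if k < i then ((-C.a i : ℝ) : AddCircle (C.cycleLength i)) else 0) =
      (if k = i then ((ξ k * C.a k : ℝ) : AddCircle (C.cycleLength i)) else 0) +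
        if k < i then ((-C.a i : ℝ) : AddCircle (C.cycleLength i)) else 0 := by
    intro k
    by_cases hk : k = i
    · simp [hk]
    · simp [hk]
  rw [Finset.sum_congr rfl (fun k _ => h k), Finset.sum_add_distrib, Finset.sum_ite_eq',
    if_pos (Finset.mem_univ _), ← Finset.sum_filter, Finset.sum_const]
  have hcard : (Finset.univ.filter fun k : Fin g => k < i).card = i.val := by
    rw [show (Finset.univ.filter fun k : Fin g => k < i) = Finset.Iio i by ext; simp, Fin.card_Iio]
  rw [hcard, AddCircle.coe_neg]
  simp [sub_eq_add_neg]

/-- A cell `p` corresponds to `r = p.1` and `d - g = p.1 - p.2 - 1`, so `rankGE_iff` says that row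
`p.1` of the displaced partition reaches column `p.2`. -/
theorem mem_W_iff (hg : 0 < g) (lam : YoungDiagram) (x : C.graph.Pic0) :
    x ∈ C.graph.W (C.marked hg) lam ↔ ∃ D : C.graph.Div0, C.graph.toPic0 D = x ∧
      ∀ p ∈ lam, displacementRow (C.Resonates D) g p.1 ≤ (p.1 : ℤ) - p.2 - 1 := by
  have hdeg : ∀ D : C.graph.Div0, C.graph.deg (D : C.graph.Divisor) = 0 := fun D => D.property
  refine exists_congr fun D => and_congr_right fun _ => ?_
  constructor
  · intro h p hp
    have := h ((g : ℤ) + p.1 - p.2 - 1) p.1 ⟨p, hp, by rw [genus_graph, boxX]; ring, rfl⟩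
    rw [C.rankGE_iff hg (hdeg D)] at this
    omega
  · rintro h d r ⟨p, hp, hx, hy⟩
    rw [genus_graph, boxX] at hx
    rw [boxY] at hy
    have hr : r = (p.1 : ℤ) := by omega
    subst hr
    rw [C.rankGE_iff hg (hdeg D)]
    have := h p hp
    omega

end ChainOfCycles

/-! ### The Brill–Noether locus as a union of tori -/

theorem theorem1p3 (g : ℕ) (hg : 0 < g) (C : ChainOfCycles g) (lam : YoungDiagram) :
    C.graph.W (C.marked hg) lam =
      ⋃ (t : {c : ℕ × ℕ // c ∈ lam} → Fin g)
        (_ : IsDisplacementTableau C.torsionOrder lam t), C.T hg t := by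
  classical
  ext x
  rw [C.mem_W_iff hg]
  simp only [Set.mem_iUnion, displacementRow_le_iff_exists_tableau]
  constructor
  · rintro ⟨D, hDx, t, hrow, hcol, hres⟩
    have hlabel : ∀ p, C.aj (t p) (D : C.graph.Divisor) = (((boxX p.val - boxY p.val : ℤ) -
        ((t p).val : ℤ))) • (C.a (t p) : AddCircle (C.cycleLength (t p))) := by
      intro p
      obtain ⟨_, h⟩ := hres p
      rw [eq_neg_of_add_eq_zero_left h]
      module
    have hmod : ∀ p p', t p = t p' → boxX p.val - boxY p.val ≡ boxX p'.val - boxY p'.val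
        [ZMOD (C.torsionOrder (t p) : ℤ)] := by
      intro p p' h
      rw [Int.modEq_iff_dvd, C.torsionOrder_dvd_iff]
      have h1 := hlabel p
      have h2 := hlabel p'
      rw [← h] at h2
      rw [h1, ← sub_eq_zero] at h2
      rw [← neg_eq_zero, ← h2]
      module
    refine ⟨t, ⟨hrow, hcol, fun p p' _ h => hmod p p' h⟩, ?_⟩
    -- A label in use takes the diagonal of one of its boxes, all its boxes being congruent; for an
    -- unused label, any real representative of the coordinate will do.
    have hξ : ∀ i : Fin g, ∃ ξ : ℝ, ((ξ * C.a i : ℝ) : AddCircle (C.cycleLength i)) =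
        C.aj i (D : C.graph.Divisor) + (i.val : ℤ) • (C.a i : AddCircle (C.cycleLength i)) ∧
        ∀ p, t p = i → ∃ p', t p' = i ∧ ξ = (boxX p'.val - boxY p'.val : ℤ) := by
      intro i
      by_cases hi : ∃ p, t p = i
      · obtain ⟨p, rfl⟩ := hi
        refine ⟨(boxX p.val - boxY p.val : ℤ), ?_, fun p' _ => ⟨p, rfl, rfl⟩⟩
        rw [hlabel p, ← zsmul_eq_mul, AddCircle.coe_zsmul]
        module
      · obtain ⟨u, hu⟩ : ∃ u : ℝ, (u : AddCircle (C.cycleLength i)) =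
            C.aj i (D : C.graph.Divisor) + (i.val : ℤ) • (C.a i : AddCircle (C.cycleLength i)) :=
          QuotientAddGroup.mk_surjective _
        refine ⟨u / C.a i, ?_, fun p hp => absurd ⟨p, hp⟩ hi⟩
        rw [div_mul_cancel₀ _ (C.a_pos i).ne', hu]
    choose ξ hξ hξ' using hξ
    refine ⟨⟨C.torusDivisor hg ξ, C.deg_torusDivisor hg ξ⟩, ξ, ?_, rfl, fun p => ?_⟩
    · rw [← hDx]
      refine QuotientAddGroup.eq.2 ?_
      rw [AddSubgroup.mem_addSubgroupOf]
      refine (C.mem_principal_iff hg _).2 ⟨AddMonoidHom.mem_ker.1 (Subtype.property _), fun i => ?_⟩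
      rw [AddSubgroup.coe_add, AddSubgroup.coe_neg, map_add, map_neg, C.aj_torusDivisor, hξ]
      abel
    · obtain ⟨p', hp', hξp⟩ := hξ' (t p) p rfl
      rw [hξp]
      obtain ⟨z, hz⟩ := (hmod p p' hp'.symm).symm.dvd
      refine AddCommGroup.modEq_iff_zsmul.2 ⟨z, ?_⟩
      rw [zsmul_eq_mul, ← Int.cast_sub, hz]
      push_cast
      ring
  · rintro ⟨t, ⟨hrow, hcol, -⟩, D, ξ, hDx, hD, hξ⟩
    refine ⟨D, hDx, t, hrow, hcol, fun p => ⟨(t p).isLt, ?_⟩⟩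
    have h1 := C.aj_torusDivisor hg ξ (t p)
    rw [C.coe_mul_a_of_modEq (t p) (hξ p)] at h1
    rw [hD]
    change C.aj (t p) (C.torusDivisor hg ξ) + _ = 0
    rw [h1]
    module
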